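/- Let $n\ge 1$, let $\mathcal M$ be a (finite-dimensional, Hausdorff, second countable, boundaryless) smooth manifold, let $\Omega$ be a multisymplectic $(n+1)$-form on $\mathcal M$, i.e. a smooth closed $(n+1)$-form such that $\xi \lrcorner\, \Omega_m = 0$ implies $\xi = 0$ for all $m\in\mathcal M$ and $\xi\in T_m\mathcal M$, and let $\mathcal H:\mathcal M\to\mathbb R$ be a smooth function. A Hamiltonian $n$-curve is an oriented embedded $n$-dimensional submanifold $\Gamma\subset\mathcal M$ (without boundary) such that for every $m\in\Gamma$ there is a nonzero $X\in\Lambda^n T_m\Gamma$ with $X\lrcorner\,\Omega_m = (-1)^n d\mathcal H_m$. A slice (of codimension $1$) is an embedded submanifold $\Sigma\subset\mathcal M$ of codimension $1$ with a smooth orientation of the normal lines $T_m\mathcal M/T_m\Sigma$ that is transverse to every Hamiltonian $n$-curve $\Gamma$; then $\Sigma\cap\Gamma$ is an $(n-1)$-dimensional submanifold, oriented so that a basis $(e_1,\dots,e_{n-1})$ of $T_m(\Sigma\cap\Gamma)$ is positive iff $(w,e_1,\dots,e_{n-1})$ is a positive basis of $T_m\Gamma$ for $w\in T_m\Gamma$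 on the positive side of $\Sigma$. A smooth $(n-1)$-form $\rho$ on $\mathcal M$ is a dynamical form if there is a smooth vector field $\Xi$ on $\mathcal M$ with $\Xi\lrcorner\,\Omega + d\rho = 0$ and $d\mathcal H(\Xi)=0$. Let $\rho$ be a dynamical $(n-1)$-form, and let $\Sigma_\circ$ and $\Sigma_\bullet$ be two slices for which there is an open subset $\mathcal D\subset\mathcal M$ with $\partial\mathcal D=\Sigma_\circ-\Sigma_\bullet$, in the following sense: every point of $\mathcal M$ has a neighbourhood $W$ in which $\Sigma_\circ$ and $\Sigma_\bullet$ are the zero sets of smooth functions $f_\circ$, $f_\bullet$ whose differentials are positive conormals of $\Sigma_\circ$, resp. $\Sigma_\bullet$, along it, and $1_{\mathcal D}=1_{\{f_\circ<0\}}-1_{\{f_\bullet<0\}}$ on $W\setminus(\Sigma_\circ\cup\Sigma_\bullet)$. (For disjoint slices: $\mathcal D$ has smooth boundary $\Sigma_\circ\cup\Sigma_\bullet$, its outward normals are positive for $\Sigma_\circ$ and negative for $\Sigma_\bullet$.) Then for every Hamiltonian $n$-curve $\Gamma$ such that the support of $\rho|_\Gamma$ (the pullback of $\rho$ to $\Gamma$)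 meets $\overline{\mathcal D}\cup\Sigma_\circ\cup\Sigma_\bullet$ in a compact set, both integrals below converge and $$\int_{\Sigma_\circ\cap\Gamma}\rho=\int_{\Sigma_\bullet\cap\Gamma}\rho .$$ -/

import Mathlib

open Set MeasureTheory Function
open scoped Manifold ContDiff ENNReal

namespace Multisymplectic

/-! ### Differential forms on a manifold `M` modelled on `E` -/

section Forms

variable (E : Type*) [NormedAddCommGroup E] [NormedSpace ℝ E]
  (M : Type*) [TopologicalSpace M] [ChartedSpace E M]

/-- A (not necessarily smooth) differential `k`-form on `M`. -/
abbrev DiffForm (k : ℕ) : Type _ :=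
  ∀ m : M, TangentSpace 𝓘(ℝ, E) m [⋀^Fin k]→L[ℝ] ℝ

variable {E M} {k : ℕ}

/-- The expression of `η` in the chart at `x₀`: the pullback of `η` under the inverse chart. -/
noncomputable def chartForm (η : DiffForm E M k) (x₀ : M) (y : E) : E [⋀^Fin k]→L[ℝ] ℝ :=
  (η ((extChartAt 𝓘(ℝ, E) x₀).symm y)).compContinuousLinearMap
    (mfderiv 𝓘(ℝ, E) 𝓘(ℝ, E) (extChartAt 𝓘(ℝ, E) x₀).symm y)

/-- `η` is smooth: its expression in every chart is smooth. -/
def IsSmoothForm (η : DiffForm E M k) : Prop :=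
  ∀ x₀ : M, ContDiffOn ℝ ∞ (chartForm η x₀) (extChartAt 𝓘(ℝ, E) x₀).target

/-- The exterior derivative of `η`, computed at `m` in the chart at `m`. -/
noncomputable def dForm (η : DiffForm E M k) : DiffForm E M (k + 1) := fun m =>
  (extDeriv (chartForm η m) (extChartAt 𝓘(ℝ, E) m m)).compContinuousLinearMap
    (mfderiv 𝓘(ℝ, E) 𝓘(ℝ, E) (extChartAt 𝓘(ℝ, E) m) m)

/-- A multisymplectic form: smooth, closed, and nondegenerate (`ξ ⌟ Ω = 0` only for `ξ = 0`). -/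
structure IsMultisymplectic (Ω : DiffForm E M (k + 1)) : Prop where
  smooth : IsSmoothForm Ω
  closed : ∀ m, dForm Ω m = 0
  nondegenerate : ∀ (m : M) (ξ : TangentSpace 𝓘(ℝ, E) m),
    (∀ v : Fin k → TangentSpace 𝓘(ℝ, E) m, Ω m (Fin.cons ξ v) = 0) → ξ = 0

/-- The differential of a function at `m`. -/
noncomputable def dFun (f : M → ℝ) (m : M) (ξ : TangentSpace 𝓘(ℝ, E) m) : ℝ :=
  mfderiv 𝓘(ℝ, E) 𝓘(ℝ, ℝ) f m ξ

/-- Dynamical `(n-1)`-forms, `n = k + 1`: smooth forms `ρ` for which there is a smooth vector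
field `Ξ` with `Ξ ⌟ Ω + dρ = 0` (so `ρ` is an algebraic observable form) and `dH(Ξ) = 0`. -/
def IsDynamical [IsManifold 𝓘(ℝ, E) ∞ M] (Ω : DiffForm E M (k + 2)) (H : M → ℝ) (ρ : DiffForm E M k) : Prop :=
  IsSmoothForm ρ ∧
  ∃ Ξ : ∀ m : M, TangentSpace 𝓘(ℝ, E) m,
    ContMDiff 𝓘(ℝ, E) 𝓘(ℝ, E).tangent ∞
      (fun m => (⟨m, Ξ m⟩ : TangentBundle 𝓘(ℝ, E) M)) ∧
    (∀ (m : M) (v : Fin (k + 1) → TangentSpace 𝓘(ℝ, E) m),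
      Ω m (Fin.cons (Ξ m) v) + dForm ρ m v = 0) ∧
    ∀ m : M, dFun H m (Ξ m) = 0

end Forms

/-! ### Embedded submanifolds, tangent spaces, orientations -/

section Submanifolds

variable {E : Type*} [NormedAddCommGroup E] [NormedSpace ℝ E]
  {M : Type*} [TopologicalSpace M] [ChartedSpace E M] {k : ℕ}

/-- The `i`-th coordinate vector `∂u/∂xᵢ` at `x` of a map `u` from `ℝᵏ` to `M`. -/
noncomputable def coordFrame (u : (Fin k → ℝ) → M) (x : Fin k → ℝ) :
    Fin k → TangentSpace 𝓘(ℝ, E) (u x) :=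
  fun i => mfderiv 𝓘(ℝ, Fin k → ℝ) 𝓘(ℝ, E) u x (Pi.single i (1 : ℝ) : Fin k → ℝ)

variable (E) in
/-- `u`, restricted to the open set `V ⊆ ℝᵏ`, is a local parametrization of `S`: an injective
smooth immersion that is a homeomorphism of `V` onto a relatively open subset of `S`. -/
structure IsLocalParam (S : Set M) (V : Set (Fin k → ℝ)) (u : (Fin k → ℝ) → M) : Prop where
  isOpen : IsOpen V
  smooth : ContMDiffOn 𝓘(ℝ, Fin k → ℝ) 𝓘(ℝ, E) ∞ u V
  immersive : ∀ x ∈ V, Injective (mfderiv 𝓘(ℝ, Fin k → ℝ) 𝓘(ℝ, E) u x)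
  injOn : InjOn u V
  relOpen : ∀ V' ⊆ V, IsOpen V' → ∃ W : Set M, IsOpen W ∧ u '' V' = S ∩ W

variable (E k) in
/-- The tangent space at `m` of a `k`-dimensional submanifold `S`, spanned by the coordinate
vectors at `m` of the local parametrizations of `S`. -/
noncomputable def tangentSub (S : Set M) (m : M) : Submodule ℝ (TangentSpace 𝓘(ℝ, E) m) :=
  Submodule.span ℝ {w | ∃ (V : Set (Fin k → ℝ)) (u : (Fin k → ℝ) → M) (x : Fin k → ℝ) (i : Fin k),
    IsLocalParam E S V u ∧ x ∈ V ∧ u x = m ∧ (w : E) = (coordFrame u x i : E)}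

variable (E M k) in
/-- An oriented embedded `k`-dimensional submanifold (without boundary) of `M`. The orientation of
`T_m S` is the one for which a basis `e` is positive when `orient m e > 0`; only the sign of
`orient m` on bases of `T_m S` matters, and it has to be locally constant along coordinate frames.
-/
structure OrientedSubmanifold where
  carrier : Set M
  exists_param : ∀ m ∈ carrier, ∃ (V : Set (Fin k → ℝ)) (u : (Fin k → ℝ) → M),
    IsLocalParam E carrier V u ∧ m ∈ u '' V
  orient : DiffForm E M k
  orient_ne_zero : ∀ (V : Set (Fin k → ℝ)) (u : (Fin k → ℝ) → M), IsLocalParam E carrier V u →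
    ∀ x ∈ V, orient (u x) (coordFrame u x) ≠ 0
  orient_continuous : ∀ (V : Set (Fin k → ℝ)) (u : (Fin k → ℝ) → M), IsLocalParam E carrier V u →
    ContinuousOn (fun x => SignType.sign (orient (u x) (coordFrame u x))) V

/-- `f` is, on the open set `W`, a smooth defining function of the hypersurface `S`, whose
differential along `S` is nonzero and a positive multiple of `ν`. (If `W` does not meet `S`, this
says that `f` is smooth without zeros on `W`.) -/
structure IsDefiningFun (S : Set M) (ν : ∀ m : M, TangentSpace 𝓘(ℝ, E) m →L[ℝ] ℝ)
    (W : Set M) (f : M → ℝ) : Prop where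
  isOpen : IsOpen W
  smooth : ContMDiffOn 𝓘(ℝ, E) 𝓘(ℝ, ℝ) ∞ f W
  zero_iff : ∀ m ∈ W, f m = 0 ↔ m ∈ S
  differential : ∀ m ∈ W ∩ S, ν m ≠ 0 ∧ ∃ c : ℝ, 0 < c ∧ ∀ ξ, dFun f m ξ = c * ν m ξ

variable (E M) in
/-- An embedded submanifold `S` of codimension one with a smooth orientation of the normal lines
`T_m M / T_m S`. Here `T_m S = ker (conormal m)`, and the class of `ξ` in `T_m M / T_m S` is
positive when `conormal m ξ > 0`; only `conormal m` up to positive factors, `m ∈ S`, matters. -/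
structure CoorientedHypersurface where
  carrier : Set M
  conormal : ∀ m : M, TangentSpace 𝓘(ℝ, E) m →L[ℝ] ℝ
  exists_defining : ∀ m ∈ carrier, ∃ (W : Set M) (f : M → ℝ),
    m ∈ W ∧ IsDefiningFun carrier conormal W f

open Classical in
/-- `∂D = S₀ - S₁` as an equality of cooriented hypersurfaces with multiplicity. Near each point,
let `U₀ = {f₀ < 0}` and `U₁ = {f₁ < 0}` be the negative sides of `S₀` and `S₁` (so that
`∂U₀ = S₀` and `∂U₁ = S₁`, cooriented by the outward normals); then `1_D = 1_{U₀} - 1_{U₁}` off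
`S₀ ∪ S₁`. When `S₀` and `S₁` are disjoint this says that `D` is a domain with smooth boundary
`S₀ ∪ S₁`, that `S₀` is cooriented by the outward normals of `D` and `S₁` by the inward ones.
Common pieces of `S₀` and `S₁` cancel. -/
def IsBoundaryDifference (D : Set M) (S₀ S₁ : CoorientedHypersurface E M) : Prop :=
  ∀ p : M, ∃ (W : Set M) (f₀ f₁ : M → ℝ), p ∈ W ∧
    IsDefiningFun S₀.carrier S₀.conormal W f₀ ∧ IsDefiningFun S₁.carrier S₁.conormal W f₁ ∧
    ∀ m ∈ W, m ∉ S₀.carrier → m ∉ S₁.carrier →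
      (if m ∈ D then (1 : ℤ) else 0) = (if f₀ m < 0 then 1 else 0) - (if f₁ m < 0 then 1 else 0)

end Submanifolds

/-! ### Hamiltonian curves and slices -/

section Dynamics

variable {E : Type*} [NormedAddCommGroup E] [NormedSpace ℝ E]
  {M : Type*} [TopologicalSpace M] [ChartedSpace E M] {k : ℕ}

/-- Hamiltonian `n`-curves, `n = k + 1`: oriented `n`-dimensional submanifolds `Γ` such that for
every `m ∈ Γ` there is a nonzero `X = v₁ ∧ ⋯ ∧ vₙ ∈ Λⁿ T_m Γ` with `X ⌟ Ω = (-1)ⁿ dH`. -/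
def IsHamiltonianCurve (Ω : DiffForm E M (k + 2)) (H : M → ℝ)
    (Γ : OrientedSubmanifold E M (k + 1)) : Prop :=
  ∀ m ∈ Γ.carrier, ∃ v : Fin (k + 1) → TangentSpace 𝓘(ℝ, E) m,
    LinearIndependent ℝ v ∧ (∀ i, v i ∈ tangentSub E (k + 1) Γ.carrier m) ∧
    ∀ ξ : TangentSpace 𝓘(ℝ, E) m,
      Ω m (Fin.snoc (α := fun _ => TangentSpace 𝓘(ℝ, E) m) v ξ) = (-1) ^ (k + 1) * dFun H m ξ

/-- A slice of codimension one: a cooriented hypersurface `S` that is transverse to every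
Hamiltonian `n`-curve `Γ`, i.e. `T_m S + T_m Γ = T_m M` for all `m ∈ S ∩ Γ`. -/
def IsSlice (Ω : DiffForm E M (k + 2)) (H : M → ℝ) (S : CoorientedHypersurface E M) : Prop :=
  ∀ Γ : OrientedSubmanifold E M (k + 1), IsHamiltonianCurve Ω H Γ →
    ∀ m ∈ S.carrier ∩ Γ.carrier,
      LinearMap.ker (S.conormal m).toLinearMap ⊔ tangentSub E (k + 1) Γ.carrier m = ⊤

/-- The support of `ρ` along `Γ`: the closure in `Γ` of the set of points of `Γ` at which the
restriction of `ρ` to the tangent space of `Γ` is nonzero. -/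
def supportAlong (Γ : OrientedSubmanifold E M (k + 1)) (ρ : DiffForm E M k) : Set M :=
  Γ.carrier ∩ closure {m | m ∈ Γ.carrier ∧
    ∃ v : Fin k → TangentSpace 𝓘(ℝ, E) m,
      (∀ i, v i ∈ tangentSub E (k + 1) Γ.carrier m) ∧ ρ m v ≠ 0}

end Dynamics

/-! ### Integration over `S ∩ Γ` -/

section Integration

variable {E : Type*} [NormedAddCommGroup E] [NormedSpace ℝ E]
  {M : Type*} [TopologicalSpace M] [ChartedSpace E M] {k : ℕ}

/-- The integral (in `[0, ∞]`) of the positive part of the density defined by the `k`-form `η` on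
the `k`-dimensional submanifold `S`, where `σ m e = ± 1` is the sign of a basis `e` of `T_m S` for
the orientation of `S`. In a local parametrization `u` the density is
`σ(∂₁u, …, ∂ₖu) η(∂₁u, …, ∂ₖu) dx₁ ⋯ dxₖ`; the total is the supremum of the sums of the integrals
over finitely many disjoint measurable pieces of `S`, each in the image of a parametrization. -/
noncomputable def posIntegral (S : Set M) (σ : ∀ m : M, (Fin k → TangentSpace 𝓘(ℝ, E) m) → ℝ)
    (η : DiffForm E M k) : ℝ≥0∞ :=
  ⨆ (N : ℕ) (V : Fin N → Set (Fin k → ℝ)) (u : Fin N → (Fin k → ℝ) → M)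
    (A : Fin N → Set (Fin k → ℝ))
    (_ : (∀ i, IsLocalParam E S (V i) (u i) ∧ MeasurableSet (A i) ∧ A i ⊆ V i) ∧
      Pairwise fun i j => Disjoint (u i '' A i) (u j '' A j)),
    ∑ i, ∫⁻ x in A i, ENNReal.ofReal
      (σ (u i x) (coordFrame (u i) x) * η (u i x) (coordFrame (u i) x))

open Classical in
/-- The orientation of `S ∩ Γ` for a cooriented hypersurface `S` transverse to the oriented
submanifold `Γ`: a basis `e` of `T_m (S ∩ Γ)` is positive (sign `1`) iff `(w, e₁, …, eₖ)` is a
positive basis of `T_m Γ` for `w ∈ T_m Γ` on the positive side of `S`. -/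
noncomputable def interSign (S : CoorientedHypersurface E M) (Γ : OrientedSubmanifold E M (k + 1))
    (m : M) (e : Fin k → TangentSpace 𝓘(ℝ, E) m) : ℝ :=
  if ∃ w ∈ tangentSub E (k + 1) Γ.carrier m, 0 < S.conormal m w ∧ 0 < Γ.orient m (Fin.cons w e)
  then 1 else -1

/-- `ρ` is integrable over `S ∩ Γ`. -/
def IntegrableOnInter (S : CoorientedHypersurface E M) (Γ : OrientedSubmanifold E M (k + 1))
    (ρ : DiffForm E M k) : Prop :=
  posIntegral (S.carrier ∩ Γ.carrier) (interSign S Γ) ρ ≠ ⊤ ∧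
  posIntegral (S.carrier ∩ Γ.carrier) (interSign S Γ) (fun m => -ρ m) ≠ ⊤

/-- The value at `Γ` of the functional `∫_S ρ`, namely `∫_{S ∩ Γ} ρ`. -/
noncomputable def sliceIntegral (S : CoorientedHypersurface E M)
    (Γ : OrientedSubmanifold E M (k + 1)) (ρ : DiffForm E M k) : ℝ :=
  (posIntegral (S.carrier ∩ Γ.carrier) (interSign S Γ) ρ).toReal -
  (posIntegral (S.carrier ∩ Γ.carrier) (interSign S Γ) (fun m => -ρ m)).toReal

end Integration

end Multisymplectic

/-! Along a Hamiltonian curve `dρ` vanishes: if `v₁, …, vₙ` is a frame of `T_m Γ` with `(v₁ ∧ ⋯ ∧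
vₙ) ⌟ Ω = (-1)ⁿ dH`, then `dρ(v₁, …, vₙ) = -Ω(Ξ, v₁, …, vₙ) = ± dH(Ξ) = 0`
(`dForm_eq_zero_of_isHamiltonianCurve`). Stokes' theorem on `D ∩ Γ`, whose boundary is `S₀ ∩ Γ - S₁
∩ Γ`, then gives the equality of the integrals.

The work lies in justifying Stokes' theorem. `Γ` need not be closed in `M`, and `S₀`, `S₁` may touch
or overlap, so `D ∩ Γ` need not be a domain with smooth boundary. Both problems disappear locally.
Near a point of `Γ` one has `1_D = 1_{f₀ < 0} - 1_{f₁ < 0}` off the hypersurfaces, so it is enough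
to apply Stokes to each region `{fⱼ < 0}` separately and subtract (`exists_nhds_stokes`). By
transversality `fⱼ` can be made the first coordinate of a parametrization of `Γ`
(`IsLocalParam.exists_adapted`), and the claim becomes Stokes for a compactly supported form on a
half-space (`setIntegral_extDeriv_halfspace`).

The local statements are added up with a finite smooth partition of unity `χᵢ` that sums to `1` on
the compact set `K` of the hypothesis. On `Sⱼ ∩ Γ` the form `∑ χᵢ ρ` has the same density as `ρ`,
and on `Γ ∩ D` its differential restricts to `dρ = 0`.

The integrals are suprema over finite families of pieces, a definition in which additivity is not
visible. `exists_reference` replaces them by ordinary integrals of functions: a measure and a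
tangent frame field are fixed on each submanifold, and every density is evaluated on that frame. -/

namespace Multisymplectic

/-! ### Derivatives of parametrizations and pullbacks of forms -/

section Pullback

variable {E : Type*} [NormedAddCommGroup E] [NormedSpace ℝ E]
  {M : Type*} [TopologicalSpace M] [ChartedSpace E M] {n k : ℕ}

/-- The derivative at `x` of a map from `ℝⁿ` to `M`, as a linear map into the model space. -/
noncomputable def derivMap (u : (Fin n → ℝ) → M) (x : Fin n → ℝ) : (Fin n → ℝ) →L[ℝ] E :=
  mfderiv 𝓘(ℝ, Fin n → ℝ) 𝓘(ℝ, E) u x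

/-- The standard frame of `ℝⁿ`. -/
def stdFrame (n : ℕ) (i : Fin n) : Fin n → ℝ := Pi.single i 1

/-- A differential form as a family of alternating maps on the model space. -/
abbrev DiffForm.toModel (η : DiffForm E M k) (m : M) : E [⋀^Fin k]→L[ℝ] ℝ := η m

/-- The pullback of a form on `M` to `ℝⁿ`. -/
noncomputable def pullForm (u : (Fin n → ℝ) → M) (η : DiffForm E M k) (x : Fin n → ℝ) :
    (Fin n → ℝ) [⋀^Fin k]→L[ℝ] ℝ :=
  (η.toModel (u x)).compContinuousLinearMap (derivMap u x)

theorem pullForm_apply (u : (Fin n → ℝ) → M) (η : DiffForm E M k) (x : Fin n → ℝ)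
    (v : Fin k → Fin n → ℝ) :
    pullForm u η x v = η.toModel (u x) (fun i => derivMap u x (v i)) := rfl

/-- The expression of `u` in the chart at `m`. -/
noncomputable def inChart (m : M) (u : (Fin n → ℝ) → M) (x : Fin n → ℝ) : E :=
  extChartAt 𝓘(ℝ, E) m (u x)

/-- The differential at `m'` of the chart at `m`. -/
noncomputable def chartDeriv (m m' : M) : E →L[ℝ] E :=
  mfderiv 𝓘(ℝ, E) 𝓘(ℝ, E) (extChartAt 𝓘(ℝ, E) m) m'

/-- The differential at `y` of the inverse of the chart at `m`. -/
noncomputable def chartSymmDeriv (m : M) (y : E) : E →L[ℝ] E :=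
  mfderiv 𝓘(ℝ, E) 𝓘(ℝ, E) (extChartAt 𝓘(ℝ, E) m).symm y

theorem IsSmoothForm.contDiffAt_chartForm {η : DiffForm E M k} (hη : IsSmoothForm η) (m : M) :
    ContDiffAt ℝ ∞ (chartForm η m) (extChartAt 𝓘(ℝ, E) m m) :=
  (hη m).contDiffAt (extChartAt_target_mem_nhds (I := 𝓘(ℝ, E)) m)

variable [IsManifold 𝓘(ℝ, E) ∞ M]

theorem contDiffAt_inChart {u : (Fin n → ℝ) → M} {x : Fin n → ℝ} {m : M}
    (hu : ContMDiffAt 𝓘(ℝ, Fin n → ℝ) 𝓘(ℝ, E) ∞ u x) (hm : u x ∈ (extChartAt 𝓘(ℝ, E) m).source) :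
    ContDiffAt ℝ ∞ (inChart (E := E) m u) x := by
  have h1 : ContMDiffAt 𝓘(ℝ, E) 𝓘(ℝ, E) ∞ (extChartAt 𝓘(ℝ, E) m) (u x) :=
    contMDiffAt_extChartAt' (by simpa using hm)
  exact (h1.comp x hu).contDiffAt

theorem fderiv_inChart {u : (Fin n → ℝ) → M} {x : Fin n → ℝ} {m : M}
    (hu : ContMDiffAt 𝓘(ℝ, Fin n → ℝ) 𝓘(ℝ, E) ∞ u x) (hm : u x ∈ (extChartAt 𝓘(ℝ, E) m).source) :
    fderiv ℝ (inChart (E := E) m u) x = (chartDeriv m (u x)).comp (derivMap u x) := by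
  have h1 : ContMDiffAt 𝓘(ℝ, E) 𝓘(ℝ, E) ∞ (extChartAt 𝓘(ℝ, E) m) (u x) :=
    contMDiffAt_extChartAt' (by simpa using hm)
  have := mfderiv_comp x (h1.mdifferentiableAt (by simp)) (hu.mdifferentiableAt (by simp))
  rw [mfderiv_eq_fderiv] at this
  exact this

theorem derivMap_eq_comp {u : (Fin n → ℝ) → M} {x : Fin n → ℝ} {m : M}
    (hu : ContMDiffAt 𝓘(ℝ, Fin n → ℝ) 𝓘(ℝ, E) ∞ u x) (hm : u x ∈ (extChartAt 𝓘(ℝ, E) m).source) :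
    derivMap (E := E) u x =
      (chartSymmDeriv m (inChart m u x)).comp (fderiv ℝ (inChart (E := E) m u) x) := by
  have hy : inChart (E := E) m u x ∈ (extChartAt 𝓘(ℝ, E) m).target :=
    (extChartAt 𝓘(ℝ, E) m).map_source hm
  have h1 : ContMDiffAt 𝓘(ℝ, E) 𝓘(ℝ, E) ∞ (extChartAt 𝓘(ℝ, E) m).symm (inChart (E := E) m u x) :=
    (contMDiffOn_extChartAt_symm m).contMDiffAt ((isOpen_extChartAt_target m).mem_nhds hy)
  have h2 := contDiffAt_inChart (E := E) hu hm
  have key : u =ᶠ[nhds x] (extChartAt 𝓘(ℝ, E) m).symm ∘ inChart (E := E) m u := by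
    have : ∀ᶠ z in nhds x, u z ∈ (extChartAt 𝓘(ℝ, E) m).source :=
      hu.continuousAt.eventually_mem ((isOpen_extChartAt_source m).mem_nhds hm)
    filter_upwards [this] with z hz
    exact ((extChartAt 𝓘(ℝ, E) m).left_inv hz).symm
  have := mfderiv_comp x (h1.mdifferentiableAt (by simp))
    (h2.contMDiffAt.mdifferentiableAt (by simp))
  rw [mfderiv_eq_fderiv] at this
  exact (key.mfderiv_eq).trans this

/-- The chart is frozen at `u x` while the point `z` moves. This turns differentiation of the
pullback at `x` into a question about forms on the vector space `E`. -/
theorem pullForm_eventuallyEq {u : (Fin n → ℝ) → M} {V : Set (Fin n → ℝ)} (hV : IsOpen V)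
    (hu : ContMDiffOn 𝓘(ℝ, Fin n → ℝ) 𝓘(ℝ, E) ∞ u V) (η : DiffForm E M k) {x : Fin n → ℝ}
    (hx : x ∈ V) :
    pullForm u η =ᶠ[nhds x] fun z => (chartForm η (u x) (inChart (u x) u z)).compContinuousLinearMap
      (fderiv ℝ (inChart (E := E) (u x) u) z) := by
  have hux := hu.contMDiffAt (hV.mem_nhds hx)
  have : ∀ᶠ z in nhds x, u z ∈ (extChartAt 𝓘(ℝ, E) (u x)).source :=
    hux.continuousAt.eventually_mem (extChartAt_source_mem_nhds (I := 𝓘(ℝ, E)) (u x))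
  filter_upwards [this, hV.mem_nhds hx] with z hz hzV
  have h := derivMap_eq_comp (E := E) (hu.contMDiffAt (hV.mem_nhds hzV)) hz
  ext v
  have h2 : (extChartAt 𝓘(ℝ, E) (u x)).symm (inChart (E := E) (u x) u z) = u z :=
    (extChartAt 𝓘(ℝ, E) (u x)).left_inv hz
  rw [pullForm_apply, h]
  change _ = η.toModel ((extChartAt 𝓘(ℝ, E) (u x)).symm (inChart (E := E) (u x) u z)) _
  rw [h2]
  rfl

theorem differentiableAt_pullForm {u : (Fin n → ℝ) → M} {V : Set (Fin n → ℝ)} (hV : IsOpen V)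
    (hu : ContMDiffOn 𝓘(ℝ, Fin n → ℝ) 𝓘(ℝ, E) ∞ u V) {η : DiffForm E M k} (hη : IsSmoothForm η)
    {x : Fin n → ℝ} (hx : x ∈ V) : DifferentiableAt ℝ (pullForm u η) x := by
  have hU := contDiffAt_inChart (E := E) (hu.contMDiffAt (hV.mem_nhds hx))
    (mem_extChartAt_source (I := 𝓘(ℝ, E)) (u x))
  refine (pullForm_eventuallyEq hV hu η hx).differentiableAt_iff.2 ?_
  refine DifferentiableAt.continuousAlternatingMapCompContinuousLinearMap ?_ ?_
  · exact ((hη.contDiffAt_chartForm (u x)).differentiableAt (by simp)).comp x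
      (hU.differentiableAt (by simp))
  · exact (hU.fderiv_right (m := 1) (by norm_cast)).differentiableAt (by simp)

/-- The exterior derivative commutes with pullback to `ℝⁿ`. -/
theorem extDeriv_pullForm {u : (Fin n → ℝ) → M} {V : Set (Fin n → ℝ)} (hV : IsOpen V)
    (hu : ContMDiffOn 𝓘(ℝ, Fin n → ℝ) 𝓘(ℝ, E) ∞ u V) {η : DiffForm E M k} (hη : IsSmoothForm η)
    {x : Fin n → ℝ} (hx : x ∈ V) : extDeriv (pullForm u η) x = pullForm u (dForm η) x := by
  have hux := hu.contMDiffAt (hV.mem_nhds hx)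
  have hU := contDiffAt_inChart (E := E) hux (mem_extChartAt_source (I := 𝓘(ℝ, E)) (u x))
  rw [(pullForm_eventuallyEq hV hu η hx).extDeriv_eq]
  have hc : ContDiffAt ℝ ∞ (chartForm η (u x)) (inChart (u x) u x) :=
    hη.contDiffAt_chartForm (u x)
  rw [extDeriv_pullback (r := ∞) (hc.differentiableAt (by simp)) hU
    (by simp [minSmoothness_of_isRCLikeNormedField]; norm_cast)]
  rw [fderiv_inChart hux (mem_extChartAt_source (I := 𝓘(ℝ, E)) (u x))]
  rfl

/-- Differentiability of the pullback as a map into alternating forms gives continuity of each of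
its coefficients. -/
theorem continuousOn_pullForm_apply {u : (Fin n → ℝ) → M} {V : Set (Fin n → ℝ)} (hV : IsOpen V)
    (hu : ContMDiffOn 𝓘(ℝ, Fin n → ℝ) 𝓘(ℝ, E) ∞ u V) {η : DiffForm E M k} (hη : IsSmoothForm η)
    (v : Fin k → Fin n → ℝ) : ContinuousOn (fun x => pullForm u η x v) V := fun _ hx =>
  ((differentiableAt_pullForm hV hu hη hx).continuousAt.eval_const v).continuousWithinAt

/-- The chart in which `dForm` is computed changes with the point, so its continuity is not
apparent. The exterior derivative of the pullback can instead be computed near `x` in the one chart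
at `u x`. -/
theorem continuousOn_extDeriv_pullForm_apply {u : (Fin n → ℝ) → M} {V : Set (Fin n → ℝ)}
    (hV : IsOpen V) (hu : ContMDiffOn 𝓘(ℝ, Fin n → ℝ) 𝓘(ℝ, E) ∞ u V) {η : DiffForm E M k}
    (hη : IsSmoothForm η) (v : Fin (k + 1) → Fin n → ℝ) :
    ContinuousOn (fun x => extDeriv (pullForm u η) x v) V := by
  intro x hx
  have hux := hu.contMDiffAt (hV.mem_nhds hx)
  have hU := contDiffAt_inChart (E := E) hux (mem_extChartAt_source (I := 𝓘(ℝ, E)) (u x))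
  have hc : ContDiffAt ℝ ∞ (chartForm η (u x)) (inChart (u x) u x) :=
    hη.contDiffAt_chartForm (u x)
  -- Only finite orders of differentiability at a point spread to a neighbourhood; order `2` is what
  -- the pullback formula for `extDeriv` needs.
  have hU' : ∀ᶠ z in nhds x, ContDiffAt ℝ 2 (inChart (E := E) (u x) u) z :=
    (hU.of_le (by norm_cast)).eventually (by simp)
  have hc' : ∀ᶠ y in nhds (inChart (E := E) (u x) u x), ContDiffAt ℝ 1 (chartForm η (u x)) y :=
    (hc.of_le (by norm_cast)).eventually (by simp)
  have key : (fun z => extDeriv (pullForm u η) z v) =ᶠ[nhds x] fun z =>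
      extDeriv (chartForm η (u x)) (inChart (u x) u z)
        (fun i => fderiv ℝ (inChart (E := E) (u x) u) z (v i)) := by
    filter_upwards [(pullForm_eventuallyEq hV hu η hx).extDeriv, hU',
      hU.continuousAt.eventually hc'] with z h1 h2 h3
    rw [h1, extDeriv_pullback (r := 2) (h3.differentiableAt (by simp)) h2
      (by simp [minSmoothness_of_isRCLikeNormedField])]
    rfl
  refine (ContinuousAt.congr ?_ key.symm).continuousWithinAt
  have hd : ContinuousAt (extDeriv (chartForm η (u x))) (inChart (u x) u x) :=
    (ContinuousAlternatingMap.alternatizeUncurryFinCLM ℝ E ℝ).continuous.continuousAt.comp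
      (hc.fderiv_right (m := 0) (by norm_cast)).continuousAt
  refine ContinuousAt.eval (hd.comp hU.continuousAt) (continuousAt_pi.2 fun i => ?_)
  exact (hU.fderiv_right (m := 0) (by norm_cast)).continuousAt.clm_apply continuousAt_const

end Pullback

/-! ### Alternating maps and determinants -/

section Determinant

theorem _root_.ContinuousAlternatingMap.apply_linearMap_stdFrame {n : ℕ}
    (f : (Fin n → ℝ) [⋀^Fin n]→L[ℝ] ℝ) (L : (Fin n → ℝ) →L[ℝ] Fin n → ℝ) :
    f (fun i => L (stdFrame n i)) = L.det * f (stdFrame n) := by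
  have h := f.toAlternatingMap.eq_smul_basis_det (Pi.basisFun ℝ (Fin n))
  have hb : ⇑(Pi.basisFun ℝ (Fin n)) = stdFrame n := by
    ext i : 1; simp [stdFrame]
  have h1 : f (fun i => L (stdFrame n i)) =
      (f.toAlternatingMap (Pi.basisFun ℝ (Fin n)) • (Pi.basisFun ℝ (Fin n)).det)
        ((L : (Fin n → ℝ) →ₗ[ℝ] (Fin n → ℝ)) ∘ (Pi.basisFun ℝ (Fin n))) := by
    rw [← h, hb]; rfl
  rw [h1, AlternatingMap.smul_apply, Module.Basis.det_comp, Module.Basis.det_self, hb, smul_eq_mul,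
    mul_one, mul_comm]
  rfl

theorem _root_.ContinuousLinearMap.det_ne_zero_of_injective {n : ℕ}
    {L : (Fin n → ℝ) →L[ℝ] Fin n → ℝ} (hL : Injective L) : L.det ≠ 0 := by
  have : LinearMap.ker (L : (Fin n → ℝ) →ₗ[ℝ] (Fin n → ℝ)) = ⊥ := LinearMap.ker_eq_bot.2 hL
  intro h
  have := LinearMap.bot_lt_ker_of_det_eq_zero (f := (L : (Fin n → ℝ) →ₗ[ℝ] (Fin n → ℝ))) h
  simp_all

end Determinant

/-! ### Local parametrizations and their transition maps -/

section TransitionMap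

variable {M : Type*} {k : ℕ} {V : Set (Fin k → ℝ)} {u u' : (Fin k → ℝ) → M} {z : Fin k → ℝ}

/-- The transition map `u⁻¹ ∘ u'` between two local parametrizations. -/
noncomputable def transition (u : (Fin k → ℝ) → M) (V : Set (Fin k → ℝ)) (u' : (Fin k → ℝ) → M)
    (z : Fin k → ℝ) : Fin k → ℝ := invFunOn u V (u' z)

theorem transition_mem (hz : u' z ∈ u '' V) : transition u V u' z ∈ V :=
  invFunOn_mem hz

theorem apply_transition (hz : u' z ∈ u '' V) : u (transition u V u' z) = u' z :=
  invFunOn_eq hz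

end TransitionMap

section Transition

variable {E : Type*} [NormedAddCommGroup E] [NormedSpace ℝ E]
  {M : Type*} [TopologicalSpace M] [ChartedSpace E M] {k : ℕ}
  {S : Set M} {V V' : Set (Fin k → ℝ)} {u u' : (Fin k → ℝ) → M} {x z : Fin k → ℝ}

namespace IsLocalParam

theorem contMDiffAt (h : IsLocalParam E S V u) (hx : x ∈ V) :
    ContMDiffAt 𝓘(ℝ, Fin k → ℝ) 𝓘(ℝ, E) ∞ u x :=
  h.smooth.contMDiffAt (h.isOpen.mem_nhds hx)

theorem continuousOn (h : IsLocalParam E S V u) : ContinuousOn u V := h.smooth.continuousOn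

theorem derivMap_injective (h : IsLocalParam E S V u) (hx : x ∈ V) :
    Injective (derivMap (E := E) u x) := h.immersive x hx

theorem mem (h : IsLocalParam E S V u) (hx : x ∈ V) : u x ∈ S := by
  obtain ⟨W, -, hW⟩ := h.relOpen V subset_rfl h.isOpen
  exact (hW ▸ mem_image_of_mem u hx : u x ∈ S ∩ W).1

theorem mono (h : IsLocalParam E S V u) (hV : V' ⊆ V) (ho : IsOpen V') :
    IsLocalParam E S V' u where
  isOpen := ho
  smooth := h.smooth.mono hV
  immersive x hx := h.immersive x (hV hx)
  injOn := h.injOn.mono hV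
  relOpen V'' hV'' := h.relOpen V'' (hV''.trans hV)

theorem empty (S : Set M) (u : (Fin k → ℝ) → M) : IsLocalParam E S ∅ u where
  isOpen := isOpen_empty
  smooth := fun _ h => h.elim
  immersive := fun _ h => h.elim
  injOn := injOn_empty u
  relOpen V' hV' _ := ⟨∅, isOpen_empty, by simp [subset_empty_iff.1 hV']⟩

end IsLocalParam

theorem IsLocalParam.transition_eq (h : IsLocalParam E S V u) (hx : x ∈ V) (hz : u x = u' z) :
    transition u V u' z = x :=
  h.injOn (transition_mem ⟨x, hx, hz⟩) hx ((apply_transition ⟨x, hx, hz⟩).trans hz.symm)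

theorem IsLocalParam.isOpen_preimage (h : IsLocalParam E S V u) (h' : IsLocalParam E S V' u') :
    IsOpen (V' ∩ u' ⁻¹' (u '' V)) := by
  obtain ⟨W, hW, hWV⟩ := h.relOpen V subset_rfl h.isOpen
  have : V' ∩ u' ⁻¹' (u '' V) = V' ∩ u' ⁻¹' W := by
    ext z
    simp only [mem_inter_iff, mem_preimage, hWV]
    exact ⟨fun h => ⟨h.1, h.2.2⟩, fun hz => ⟨hz.1, h'.mem hz.1, hz.2⟩⟩
  rw [this]
  exact h'.continuousOn.isOpen_inter_preimage h'.isOpen hW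

theorem IsLocalParam.eventually_mem_image (h : IsLocalParam E S V u) (h' : IsLocalParam E S V' u')
    (hz : z ∈ V' ∩ u' ⁻¹' (u '' V)) : ∀ᶠ y in nhds z, y ∈ V' ∧ u' y ∈ u '' V :=
  (h.isOpen_preimage h').mem_nhds hz

/-- Shrinking `V` to a neighbourhood of the image point leaves a local parametrization, whose image
is again relatively open in `S`; its preimage under `u'` is the required neighbourhood. -/
theorem IsLocalParam.continuousAt_transition (h : IsLocalParam E S V u)
    (h' : IsLocalParam E S V' u') (hz : z ∈ V' ∩ u' ⁻¹' (u '' V)) :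
    ContinuousAt (transition u V u') z := by
  intro N hN
  obtain ⟨N', hN', hN'o, hxN'⟩ := mem_nhds_iff.1 hN
  have h2 := h.mono (V' := V ∩ N') inter_subset_left (h.isOpen.inter hN'o)
  have hz2 : z ∈ V' ∩ u' ⁻¹' (u '' (V ∩ N')) :=
    ⟨hz.1, transition u V u' z, ⟨transition_mem hz.2, hxN'⟩, apply_transition hz.2⟩
  refine Filter.mem_map.2 ?_
  filter_upwards [h2.eventually_mem_image h' hz2] with y ⟨hy, w, hw, hwy⟩
  rw [mem_preimage, h.transition_eq hw.1 hwy]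
  exact hN' hw.2

variable [IsManifold 𝓘(ℝ, E) ∞ M] [FiniteDimensional ℝ E]

/-- Compose the chart expression of `u` with a linear left inverse `L` of its derivative at `x`. The
result `G` has derivative the identity, hence a smooth local inverse, and the transition map is `G⁻¹
∘ L ∘ u'` in the chart. Continuity of the transition map is needed first, to stay where `G⁻¹`
inverts `G`. -/
theorem IsLocalParam.contDiffAt_transition (h : IsLocalParam E S V u)
    (h' : IsLocalParam E S V' u') (hz : z ∈ V' ∩ u' ⁻¹' (u '' V)) :
    ContDiffAt ℝ ∞ (transition u V u') z := by
  set x := transition u V u' z with hx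
  have hxV : x ∈ V := transition_mem hz.2
  have hux : u x = u' z := apply_transition hz.2
  have hsrc : u x ∈ (extChartAt 𝓘(ℝ, E) (u x)).source := mem_extChartAt_source (u x)
  have hU := contDiffAt_inChart (E := E) (h.contMDiffAt hxV) hsrc
  have hU' := contDiffAt_inChart (E := E) (m := u x) (h'.contMDiffAt hz.1) (hux ▸ hsrc)
  have hinj : Injective (fderiv ℝ (inChart (E := E) (u x) u) x) := by
    rw [fderiv_inChart (h.contMDiffAt hxV) hsrc]
    have := IsManifold.of_le (I := 𝓘(ℝ, E)) (M := M) (m := 1) (n := ∞) (by norm_cast)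
    have h1 : (chartDeriv (E := E) (u x) (u x)).IsInvertible := isInvertible_mfderiv_extChartAt hsrc
    obtain ⟨e, he⟩ := h1
    rw [← he]
    exact e.injective.comp (h.derivMap_injective hxV)
  obtain ⟨g, hg⟩ := LinearMap.exists_leftInverse_of_injective
    (fderiv ℝ (inChart (E := E) (u x) u) x).toLinearMap (LinearMap.ker_eq_bot.2 hinj)
  set L : E →L[ℝ] Fin k → ℝ := LinearMap.toContinuousLinearMap g
  have hG : ContDiffAt ℝ ∞ (fun y => L (inChart (u x) u y)) x := L.contDiff.contDiffAt.comp x hU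
  have hGd : HasFDerivAt (fun y => L (inChart (u x) u y))
      ((ContinuousLinearEquiv.refl ℝ (Fin k → ℝ) : (Fin k → ℝ) →L[ℝ] Fin k → ℝ)) x := by
    have := L.hasFDerivAt.comp x (hU.differentiableAt (by simp)).hasFDerivAt
    exact this.congr_fderiv (ContinuousLinearMap.ext fun v => LinearMap.congr_fun hg v)
  have hG' := hG.to_localInverse hGd (by simp)
  have hleft := (hG.hasStrictFDerivAt' hGd (by simp)).eventually_left_inverse
  have hcomp : ContDiffAt ℝ ∞ (fun y => hG.localInverse hGd (by simp) (L (inChart (u x) u' y))) z := by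
    refine ContDiffAt.comp z (f := fun y => L (inChart (u x) u' y)) ?_
      (L.contDiff.contDiffAt.comp z hU')
    have : inChart (E := E) (u x) u' z = inChart (u x) u x := by simp [inChart, hux]
    rw [this]
    exact hG'
  refine hcomp.congr_of_eventuallyEq ?_
  filter_upwards [h.eventually_mem_image h' hz,
    (h.continuousAt_transition h' hz).eventually hleft] with y hy hy'
  have : inChart (E := E) (u x) u' y = inChart (u x) u (transition u V u' y) := by
    simp [inChart, apply_transition hy.2]
  rw [this]
  exact hy'.symm

theorem IsLocalParam.hasFDerivAt_transition (h : IsLocalParam E S V u)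
    (h' : IsLocalParam E S V' u') (hz : z ∈ V' ∩ u' ⁻¹' (u '' V)) :
    HasFDerivAt (transition u V u') (fderiv ℝ (transition u V u') z) z :=
  ((h.contDiffAt_transition h' hz).differentiableAt (by simp)).hasFDerivAt

theorem IsLocalParam.derivMap_transition (h : IsLocalParam E S V u)
    (h' : IsLocalParam E S V' u') (hz : z ∈ V' ∩ u' ⁻¹' (u '' V)) :
    derivMap (E := E) u' z =
      (derivMap u (transition u V u' z)).comp (fderiv ℝ (transition u V u') z) := by
  have key : u' =ᶠ[nhds z] u ∘ transition u V u' := by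
    filter_upwards [h.eventually_mem_image h' hz] with y hy
    exact (apply_transition hy.2).symm
  have := mfderiv_comp z ((h.contMDiffAt (transition_mem hz.2)).mdifferentiableAt (by simp))
    ((h.contDiffAt_transition h' hz).contMDiffAt.mdifferentiableAt (by simp))
  rw [mfderiv_eq_fderiv] at this
  exact (key.mfderiv_eq).trans this

theorem IsLocalParam.det_transition_ne_zero (h : IsLocalParam E S V u)
    (h' : IsLocalParam E S V' u') (hz : z ∈ V' ∩ u' ⁻¹' (u '' V)) :
    (fderiv ℝ (transition u V u') z).det ≠ 0 := by
  apply ContinuousLinearMap.det_ne_zero_of_injective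
  have := h'.derivMap_injective hz.1
  rw [h.derivMap_transition h' hz] at this
  exact Injective.of_comp this

/-- The tangent space is spanned by the frames of all parametrizations, but the chain rule for
transition maps puts each of them in the range of the derivative of a single one. -/
theorem IsLocalParam.tangentSub_eq (h : IsLocalParam E S V u) (hx : x ∈ V) (w : E) :
    w ∈ tangentSub E k S (u x) ↔ ∃ a, w = derivMap (E := E) u x a := by
  constructor
  · intro hw
    have hle : tangentSub E k S (u x) ≤ LinearMap.range (derivMap (E := E) u x).toLinearMap := by
      refine Submodule.span_le.2 ?_
      rintro w ⟨V', u', z, i, h', hz, hzx, hw⟩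
      have hz' : z ∈ V' ∩ u' ⁻¹' (u '' V) := ⟨hz, x, hx, hzx.symm⟩
      have ht := h.transition_eq hx hzx.symm
      refine ⟨fderiv ℝ (transition u V u') z (stdFrame k i), ?_⟩
      have := h.derivMap_transition h' hz'
      rw [ht] at this
      refine Eq.trans ?_ hw.symm
      change _ = derivMap (E := E) u' z (stdFrame k i)
      rw [this]
      rfl
    obtain ⟨a, ha⟩ := hle hw
    exact ⟨a, ha.symm⟩
  · rintro ⟨a, rfl⟩
    have : a = ∑ i, a i • stdFrame k i := by
      ext j; simp [stdFrame, Finset.sum_apply, Pi.single_apply]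
    rw [this, map_sum]
    refine Submodule.sum_mem _ fun i _ => ?_
    rw [map_smul]
    have hi : (derivMap (E := E) u x (stdFrame k i) : TangentSpace 𝓘(ℝ, E) (u x)) ∈
        tangentSub E k S (u x) := Submodule.subset_span ⟨V, u, x, i, h, hx, rfl, rfl⟩
    exact (tangentSub E k S (u x)).smul_mem (a i) hi

end Transition

/-! ### Densities on a submanifold and a reference measure -/

section Density

variable {E : Type*} [NormedAddCommGroup E] [NormedSpace ℝ E]
  {M : Type*} [TopologicalSpace M] [ChartedSpace E M] {k : ℕ}
  {S : Set M} {V V' : Set (Fin k → ℝ)} {u u' : (Fin k → ℝ) → M} {x z : Fin k → ℝ}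

/-- The coordinate frame of `u` at `x` as a family of vectors of the model space. -/
noncomputable def frame (u : (Fin k → ℝ) → M) (x : Fin k → ℝ) : Fin k → E :=
  fun i => derivMap u x (stdFrame k i)

/-- `δ` is a continuous density on `S`: its values on the tangent frames of `S` are multiplied by
`|det L|` under a change of frame `L`, and are continuous along every local parametrization. -/
structure IsDensity (S : Set M) (δ : M → (Fin k → E) → ℝ) : Prop where
  map_det : ∀ (V : Set (Fin k → ℝ)) (u : (Fin k → ℝ) → M), IsLocalParam E S V u → ∀ x ∈ V,
    ∀ L : (Fin k → ℝ) →L[ℝ] Fin k → ℝ, L.det ≠ 0 →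
      δ (u x) (fun i => derivMap u x (L (stdFrame k i))) = |L.det| * δ (u x) (frame u x)
  continuousOn : ∀ (V : Set (Fin k → ℝ)) (u : (Fin k → ℝ) → M), IsLocalParam E S V u →
    ContinuousOn (fun x => δ (u x) (frame u x)) V

namespace IsDensity

variable {δ : M → (Fin k → E) → ℝ}

theorem neg (h : IsDensity S δ) : IsDensity S (fun m e => -δ m e) where
  map_det V u hu x hx L hL := by rw [h.map_det V u hu x hx L hL]; ring
  continuousOn V u hu := (h.continuousOn V u hu).neg

theorem abs (h : IsDensity S δ) : IsDensity S (fun m e => |δ m e|) where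
  map_det V u hu x hx L hL := by rw [h.map_det V u hu x hx L hL, abs_mul, abs_abs]
  continuousOn V u hu := (h.continuousOn V u hu).abs

variable [IsManifold 𝓘(ℝ, E) ∞ M] [FiniteDimensional ℝ E]

theorem apply_transition (h : IsDensity S δ) (hu : IsLocalParam E S V u)
    (hu' : IsLocalParam E S V' u') (hz : z ∈ V' ∩ u' ⁻¹' (u '' V)) :
    δ (u' z) (frame u' z) = |(fderiv ℝ (transition u V u') z).det| *
      δ (u (transition u V u' z)) (frame u (transition u V u' z)) := by
  rw [← h.map_det V u hu _ (transition_mem hz.2) _ (hu.det_transition_ne_zero hu' hz),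
    Multisymplectic.apply_transition hz.2]
  congr 1
  unfold frame
  rw [hu.derivMap_transition hu' hz]
  rfl

/-- It suffices to check the conditions on a density in one parametrization around each point. -/
theorem of_local (h : ∀ m ∈ S, ∃ (V : Set (Fin k → ℝ)) (u : (Fin k → ℝ) → M),
      IsLocalParam E S V u ∧ m ∈ u '' V ∧
      (∀ x ∈ V, ∀ L : (Fin k → ℝ) →L[ℝ] Fin k → ℝ, L.det ≠ 0 →
        δ (u x) (fun i => derivMap u x (L (stdFrame k i))) = |L.det| * δ (u x) (frame u x)) ∧
      ContinuousOn (fun x => δ (u x) (frame u x)) V) : IsDensity S δ := by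
  have key : ∀ (V' : Set (Fin k → ℝ)) (u' : (Fin k → ℝ) → M), IsLocalParam E S V' u' →
      ∀ x ∈ V', (∀ L : (Fin k → ℝ) →L[ℝ] Fin k → ℝ, L.det ≠ 0 →
        δ (u' x) (fun i => derivMap u' x (L (stdFrame k i))) = |L.det| * δ (u' x) (frame u' x)) ∧
        ContinuousAt (fun x => δ (u' x) (frame u' x)) x := by
    intro V' u' hu' x hx
    obtain ⟨V, u, hu, hm, hdet, hc⟩ := h (u' x) (hu'.mem hx)
    have hfr : ∀ z ∈ V' ∩ u' ⁻¹' (u '' V), δ (u' z) (frame u' z) =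
        |(fderiv ℝ (transition u V u') z).det| *
          δ (u (transition u V u' z)) (frame u (transition u V u' z)) := by
      intro z hz
      rw [← hdet _ (transition_mem hz.2) _ (hu.det_transition_ne_zero hu' hz),
        Multisymplectic.apply_transition hz.2]
      unfold frame
      rw [hu.derivMap_transition hu' hz]
      rfl
    have hxO : x ∈ V' ∩ u' ⁻¹' (u '' V) := ⟨hx, hm⟩
    constructor
    · intro L hL
      have hd := hu.det_transition_ne_zero hu' hxO
      have h1 := hdet _ (transition_mem hm) ((fderiv ℝ (transition u V u') x).comp L)
        (by simpa [ContinuousLinearMap.det] using ⟨hd, hL⟩)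
      have hdc : ((fderiv ℝ (transition u V u') x).comp L).det =
        (fderiv ℝ (transition u V u') x).det * L.det := by simp [ContinuousLinearMap.det]
      rw [hdc, abs_mul, mul_assoc, mul_left_comm] at h1
      rw [hfr x hxO, ← h1, Multisymplectic.apply_transition hm, hu.derivMap_transition hu' hxO]
      rfl
    · have hθ := hu.contDiffAt_transition hu' hxO
      have h2 : ContinuousAt (fun z => |(fderiv ℝ (transition u V u') z).det| *
          δ (u (transition u V u' z)) (frame u (transition u V u' z))) x := by
        refine ContinuousAt.mul ?_ ?_
        · exact (ContinuousLinearMap.continuous_det.continuousAt.comp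
            (hθ.fderiv_right (m := 0) (by norm_cast)).continuousAt).abs
        · exact ContinuousAt.comp (f := transition u V u') (g := fun x => δ (u x) (frame u x))
            (hc.continuousAt (hu.isOpen.mem_nhds (transition_mem hm))) hθ.continuousAt
      refine h2.congr ?_
      filter_upwards [hu.eventually_mem_image hu' hxO] with z hz
      exact (hfr z hz).symm
  exact ⟨fun V u hu x hx => (key V u hu x hx).1,
    fun V u hu x hx => (key V u hu x hx).2.continuousWithinAt⟩

/-- This is the change of variables formula for the transition map: its Jacobian is exactly the
factor by which a density changes. -/
theorem lintegral_eq_of_image_eq (h : IsDensity S δ) (hu : IsLocalParam E S V u)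
    (hu' : IsLocalParam E S V' u') {A A' : Set (Fin k → ℝ)} (hA : A ⊆ V) (hA' : A' ⊆ V')
    (hm : MeasurableSet A') (heq : u '' A = u' '' A') :
    ∫⁻ x in A, ENNReal.ofReal (δ (u x) (frame u x)) =
      ∫⁻ x in A', ENNReal.ofReal (δ (u' x) (frame u' x)) := by
  have hsub : ∀ z ∈ A', z ∈ V' ∩ u' ⁻¹' (u '' V) := fun z hz =>
    ⟨hA' hz, image_mono hA (heq ▸ mem_image_of_mem u' hz)⟩
  have himg : transition u V u' '' A' = A := by
    ext y
    constructor
    · rintro ⟨z, hz, rfl⟩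
      obtain ⟨y, hy, hyz⟩ := heq ▸ mem_image_of_mem u' hz
      rwa [hu.transition_eq (hA hy) hyz]
    · intro hy
      obtain ⟨z, hz, hyz⟩ := heq.symm ▸ mem_image_of_mem u hy
      exact ⟨z, hz, hu.transition_eq (hA hy) hyz.symm⟩
  have hinj : InjOn (transition u V u') A' := by
    intro z hz w hw hzw
    refine hu'.injOn (hA' hz) (hA' hw) ?_
    rw [← Multisymplectic.apply_transition (hsub z hz).2, hzw,
      Multisymplectic.apply_transition (hsub w hw).2]
  rw [← himg, lintegral_image_eq_lintegral_abs_det_fderiv_mul volume hm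
    (fun z hz => (hu.hasFDerivAt_transition hu' (hsub z hz)).hasFDerivWithinAt) hinj]
  refine setLIntegral_congr_fun hm fun z hz => ?_
  rw [h.apply_transition hu hu' (hsub z hz), ENNReal.ofReal_mul (abs_nonneg _)]

end IsDensity

/-- A measure `μ` on the submanifold `S` and a tangent frame field `e` of `S` with respect to which
all densities on `S` can be integrated as functions. -/
structure IsReference [MeasurableSpace M] (S : Set M) (μ : Measure M) (e : M → Fin k → E) :
    Prop where
  lintegral_image : ∀ δ : M → (Fin k → E) → ℝ, IsDensity S δ →
    ∀ (V : Set (Fin k → ℝ)) (u : (Fin k → ℝ) → M) (A : Set (Fin k → ℝ)), IsLocalParam E S V u →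
    MeasurableSet A → A ⊆ V →
    ∫⁻ m in u '' A, ENNReal.ofReal (δ m (e m)) ∂μ =
      ∫⁻ x in A, ENNReal.ofReal (δ (u x) (frame u x))
  aemeasurable : ∀ δ : M → (Fin k → E) → ℝ, IsDensity S δ → AEMeasurable (fun m => δ m (e m)) μ
  ae_frame : ∀ᵐ m ∂μ, ∃ (V : Set (Fin k → ℝ)) (u : (Fin k → ℝ) → M) (x : Fin k → ℝ),
    IsLocalParam E S V u ∧ x ∈ V ∧ u x = m ∧ e m = frame u x
  posIntegral_eq : ∀ (σ : ∀ m : M, (Fin k → TangentSpace 𝓘(ℝ, E) m) → ℝ) (η : DiffForm E M k),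
    IsDensity S (fun m e => σ m e * η.toModel m e) →
    posIntegral S σ η = ∫⁻ m, ENNReal.ofReal (σ m (e m) * η.toModel m (e m)) ∂μ

/-- Second countability yields countably many parametrized patches covering `S`; from each, the
earlier ones are removed. Measurability of the pieces in any parametrization follows because they
are differences of relatively open sets. -/
theorem exists_disjoint_pieces [SecondCountableTopology M] [Nonempty M]
    (hS : ∀ m ∈ S, ∃ (V : Set (Fin k → ℝ)) (u : (Fin k → ℝ) → M),
      IsLocalParam E S V u ∧ m ∈ u '' V) :
    ∃ (V : ℕ → Set (Fin k → ℝ)) (u : ℕ → (Fin k → ℝ) → M) (A : ℕ → Set (Fin k → ℝ)),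
      (∀ j, IsLocalParam E S (V j) (u j)) ∧ (∀ j, MeasurableSet (A j)) ∧ (∀ j, A j ⊆ V j) ∧
      (Pairwise fun i j => Disjoint (u i '' A i) (u j '' A j)) ∧ S ⊆ ⋃ j, u j '' A j ∧
      ∀ (V' : Set (Fin k → ℝ)) (u' : (Fin k → ℝ) → M), IsLocalParam E S V' u' → ∀ j,
        MeasurableSet (V' ∩ u' ⁻¹' (u j '' A j)) := by
  classical
  choose! V₀ u₀ h₀ hm₀ using hS
  obtain ⟨t, htS, htc, htU⟩ := TopologicalSpace.countable_cover_nhdsWithin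
    (f := fun m => u₀ m '' V₀ m) (s := S) (fun m hm => by
      obtain ⟨W, hW, hWV⟩ := (h₀ m hm).relOpen _ subset_rfl (h₀ m hm).isOpen
      rw [hWV, mem_nhdsWithin]
      exact ⟨W, hW, (hWV ▸ hm₀ m hm : m ∈ S ∩ W).2, fun z hz => ⟨hz.2, hz.1⟩⟩)
  obtain ⟨g, hg⟩ := countable_iff_exists_subset_range.1 htc
  -- The enumeration `g` may take values outside the chosen centres; where it leaves `S`, the patch
  -- is empty.
  let V : ℕ → Set (Fin k → ℝ) := fun j => if g j ∈ S then V₀ (g j) else ∅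
  let u : ℕ → (Fin k → ℝ) → M := fun j => u₀ (g j)
  have hV : ∀ j, IsLocalParam E S (V j) (u j) := by
    intro j
    by_cases hj : g j ∈ S
    · simpa [V, hj] using h₀ _ hj
    · simpa [V, hj] using IsLocalParam.empty S _
  have hcov : S ⊆ ⋃ j, u j '' V j := by
    intro m hm
    obtain ⟨a, ha, hma⟩ := mem_iUnion₂.1 (htU hm)
    obtain ⟨j, rfl⟩ := hg ha
    refine mem_iUnion.2 ⟨j, ?_⟩
    simpa [V, u, htS ha] using hma
  let B : ℕ → Set M := fun j => u j '' V j \ ⋃ i < j, u i '' V i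
  let A : ℕ → Set (Fin k → ℝ) := fun j => V j ∩ u j ⁻¹' (B j)
  have hAB : ∀ j, u j '' A j = B j := by
    intro j
    simp only [A, image_inter_preimage]
    exact inter_eq_right.2 sdiff_subset
  have hmeas : ∀ (V' : Set (Fin k → ℝ)) (u' : (Fin k → ℝ) → M), IsLocalParam E S V' u' → ∀ j,
      MeasurableSet (V' ∩ u' ⁻¹' (B j)) := by
    intro V' u' hu' j
    have : V' ∩ u' ⁻¹' (B j) = (V' ∩ u' ⁻¹' (u j '' V j)) \ ⋃ i < j, V' ∩ u' ⁻¹' (u i '' V i) := by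
      ext z
      simp only [B, mem_inter_iff, mem_preimage, mem_sdiff, mem_iUnion, not_exists]
      tauto
    rw [this]
    refine ((hV j).isOpen_preimage hu').measurableSet.diff ?_
    exact MeasurableSet.iUnion fun i => MeasurableSet.iUnion fun _ =>
      ((hV i).isOpen_preimage hu').measurableSet
  have hdisj : ∀ i j, i < j → Disjoint (B i) (B j) := by
    intro i j hij
    refine Set.disjoint_left.2 fun m hi hj => hj.2 ?_
    exact mem_iUnion₂.2 ⟨i, hij, hi.1⟩
  refine ⟨V, u, A, hV, fun j => hmeas _ _ (hV j) j, fun j => inter_subset_left, ?_, ?_, ?_⟩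
  · intro i j hij
    rw [hAB, hAB]
    rcases lt_or_gt_of_ne hij with h | h
    · exact hdisj i j h
    · exact (hdisj j i h).symm
  · intro m hm
    have hex : ∃ j, m ∈ u j '' V j := mem_iUnion.1 (hcov hm)
    refine mem_iUnion.2 ⟨Nat.find hex, ?_⟩
    rw [hAB]
    refine ⟨Nat.find_spec hex, fun h => ?_⟩
    obtain ⟨i, hi, hmi⟩ := mem_iUnion₂.1 h
    exact Nat.find_min hex hi hmi
  · intro V' u' hu' j
    rw [hAB]
    exact hmeas V' u' hu' j

end Density

/-! ### Existence of reference measures and frames on a submanifold -/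

section Reference

variable {E : Type*} [NormedAddCommGroup E] [NormedSpace ℝ E]
  {M : Type*} [TopologicalSpace M] [ChartedSpace E M] {k : ℕ}
  {S : Set M} {V : Set (Fin k → ℝ)} {u : (Fin k → ℝ) → M}

theorem IsLocalParam.measurableSet_image [T2Space M] [MeasurableSpace M] [BorelSpace M]
    (h : IsLocalParam E S V u) {A : Set (Fin k → ℝ)} (hA : MeasurableSet A) (hAV : A ⊆ V) :
    MeasurableSet (u '' A) :=
  hA.image_of_continuousOn_injOn (h.continuousOn.mono hAV) (h.injOn.mono hAV)

variable [IsManifold 𝓘(ℝ, E) ∞ M] [FiniteDimensional ℝ E]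

/-- On each of countably many disjoint pieces `u j '' A j`, let `μ` be the image of Lebesgue measure
and `e` the coordinate frame of `u j`. A density evaluated on `e` then integrates as in the
coordinates of the piece, and any other parametrization is handled by cutting its domain along the
pieces and changing variables. -/
theorem exists_reference [T2Space M] [SecondCountableTopology M] [Nonempty M]
    [MeasurableSpace M] [BorelSpace M]
    (hS : ∀ m ∈ S, ∃ (V : Set (Fin k → ℝ)) (u : (Fin k → ℝ) → M),
      IsLocalParam E S V u ∧ m ∈ u '' V) :
    ∃ (μ : Measure M) (e : M → Fin k → E), IsReference S μ e := by
  classical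
  obtain ⟨V, u, A, hV, hAm, hAV, hdisj, hcov, hpre⟩ := exists_disjoint_pieces hS
  have hemb : ∀ j, MeasurableEmbedding ((A j).domRestrict (u j)) := fun j =>
    ContinuousOn.measurableEmbedding (hAm j) ((hV j).continuousOn.mono (hAV j))
      ((hV j).injOn.mono (hAV j))
  let μ : Measure M := Measure.sum fun j =>
    (Measure.comap Subtype.val volume : Measure (A j)).map ((A j).domRestrict (u j))
  let e : M → Fin k → E := fun m =>
    if h : ∃ p : ℕ × (Fin k → ℝ), p.2 ∈ A p.1 ∧ u p.1 p.2 = m then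
      frame (u h.choose.1) h.choose.2 else 0
  have he : ∀ j, ∀ x ∈ A j, e (u j x) = frame (u j) x := by
    intro j x hx
    have h : ∃ p : ℕ × (Fin k → ℝ), p.2 ∈ A p.1 ∧ u p.1 p.2 = u j x := ⟨(j, x), hx, rfl⟩
    have huniq : ∀ p : ℕ × (Fin k → ℝ), p.2 ∈ A p.1 ∧ u p.1 p.2 = u j x → p = (j, x) := by
      rintro ⟨i, y⟩ h2
      have hij : i = j := by
        by_contra hne
        exact Set.disjoint_left.1 (hdisj hne) ⟨y, h2.1, rfl⟩ ⟨x, hx, h2.2.symm⟩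
      subst hij
      exact Prod.ext rfl ((hV i).injOn (hAV i h2.1) (hAV i hx) h2.2)
    have hp := huniq _ h.choose_spec
    simp only [e, dif_pos h]
    rw [hp]
  have hlint : ∀ f : M → ℝ≥0∞, ∫⁻ m, f m ∂μ = ∑' j, ∫⁻ x in A j, f (u j x) := by
    intro f
    rw [lintegral_sum_measure]
    refine tsum_congr fun j => ?_
    rw [(hemb j).lintegral_map]
    exact lintegral_subtype_comap (hAm j) (fun x => f (u j x))
  have hfr : ∀ δ : M → (Fin k → E) → ℝ, ∀ j,
      ∫⁻ x in A j, ENNReal.ofReal (δ (u j x) (e (u j x))) =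
        ∫⁻ x in A j, ENNReal.ofReal (δ (u j x) (frame (u j) x)) := fun δ j =>
    setLIntegral_congr_fun (hAm j) fun x hx => by simp only [he j x hx]
  have himage : ∀ δ : M → (Fin k → E) → ℝ, IsDensity S δ →
      ∀ (V' : Set (Fin k → ℝ)) (u' : (Fin k → ℝ) → M) (A' : Set (Fin k → ℝ)),
      IsLocalParam E S V' u' → MeasurableSet A' → A' ⊆ V' →
      ∫⁻ m in u' '' A', ENNReal.ofReal (δ m (e m)) ∂μ =
        ∫⁻ x in A', ENNReal.ofReal (δ (u' x) (frame u' x)) := by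
    intro δ hδ V' u' A' hu' hA' hAV'
    have hmi := hu'.measurableSet_image hA' hAV'
    rw [← lintegral_indicator hmi, hlint]
    have hP : ∀ j, MeasurableSet (A' ∩ u' ⁻¹' (u j '' A j)) := by
      intro j
      have : A' ∩ u' ⁻¹' (u j '' A j) = A' ∩ (V' ∩ u' ⁻¹' (u j '' A j)) := by
        rw [← inter_assoc, inter_eq_left.2 hAV']
      rw [this]
      exact hA'.inter (hpre V' u' hu' j)
    have hun : A' = ⋃ j, A' ∩ u' ⁻¹' (u j '' A j) := by
      rw [← inter_iUnion, ← preimage_iUnion]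
      exact (inter_eq_left.2 fun x hx => (hcov (hu'.mem (hAV' hx)) : u' x ∈ _)).symm
    have hpd : Pairwise (Function.onFun Disjoint fun j => A' ∩ u' ⁻¹' (u j '' A j)) := by
      intro i j hij
      refine Set.disjoint_left.2 fun x hi hj => ?_
      exact Set.disjoint_left.1 (hdisj hij) hi.2 hj.2
    conv_rhs => rw [hun, lintegral_iUnion hP hpd]
    refine tsum_congr fun j => ?_
    have hmj : MeasurableSet (A j ∩ u j ⁻¹' (u' '' A')) := by
      have := (hemb j).measurable hmi
      have := (hAm j).subtype_image this
      rwa [show (Subtype.val '' ((A j).domRestrict (u j) ⁻¹' (u' '' A'))) =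
        A j ∩ u j ⁻¹' (u' '' A') by ext x; simp [domRestrict, and_comm]] at this
    have hstep : ∫⁻ x in A j, (u' '' A').indicator (fun m => ENNReal.ofReal (δ m (e m))) (u j x) =
        ∫⁻ x in A j ∩ u j ⁻¹' (u' '' A'), ENNReal.ofReal (δ (u j x) (frame (u j) x)) := by
      rw [← lintegral_indicator (hAm j), ← lintegral_indicator hmj]
      refine lintegral_congr fun x => ?_
      by_cases hx : x ∈ A j
      · by_cases hx' : u j x ∈ u' '' A'
        · rw [indicator_of_mem hx, indicator_of_mem hx',
            indicator_of_mem (show x ∈ A j ∩ u j ⁻¹' (u' '' A') from ⟨hx, hx'⟩), he j x hx]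
        · rw [indicator_of_mem hx, indicator_of_notMem hx',
            indicator_of_notMem fun h : x ∈ A j ∩ u j ⁻¹' (u' '' A') => hx' h.2]
      · rw [indicator_of_notMem hx, indicator_of_notMem fun h : x ∈ A j ∩ u j ⁻¹' (u' '' A') => hx h.1]
    rw [hstep]
    refine hδ.lintegral_eq_of_image_eq (hV j) hu' (inter_subset_left.trans (hAV j))
      (inter_subset_left.trans hAV') (hP j) ?_
    rw [image_inter_preimage, image_inter_preimage, inter_comm]
  have htotal : ∀ δ : M → (Fin k → E) → ℝ, ∫⁻ m, ENNReal.ofReal (δ m (e m)) ∂μ =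
      ∑' j, ∫⁻ x in A j, ENNReal.ofReal (δ (u j x) (frame (u j) x)) := fun δ => by
    rw [hlint]
    exact tsum_congr fun j => hfr δ j
  refine ⟨μ, e, himage, ?_, ?_, ?_⟩
  · intro δ hδ
    refine aemeasurable_sum_measure_iff.2 fun j => ?_
    rw [(hemb j).aemeasurable_map_iff]
    have hc : Continuous ((A j).domRestrict fun x => δ (u j x) (frame (u j) x)) :=
      continuousOn_iff_continuous_domRestrict.1 ((hδ.continuousOn _ _ (hV j)).mono (hAV j))
    have heq : ((fun m => δ m (e m)) ∘ (A j).domRestrict (u j)) =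
        (A j).domRestrict fun x => δ (u j x) (frame (u j) x) := by
      ext x
      simp [domRestrict, he j x x.2]
    rw [heq]
    exact hc.measurable.aemeasurable
  · refine Measure.ae_sum_iff.2 fun j => ?_
    rw [(hemb j).ae_map_iff]
    exact Filter.Eventually.of_forall fun x => ⟨V j, u j, x, hV j, hAV j x.2, rfl, he j x x.2⟩
  · intro σ η hδ
    refine le_antisymm ?_ ?_
    · refine iSup_le fun N => iSup_le fun V' => iSup_le fun u' => iSup_le fun A' => iSup_le ?_
      rintro ⟨h, hd⟩
      calc _ = ∑ i, ∫⁻ m in u' i '' A' i, ENNReal.ofReal (σ m (e m) * η.toModel m (e m)) ∂μ :=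
            Finset.sum_congr rfl fun i _ =>
              (himage _ hδ (V' i) (u' i) (A' i) (h i).1 (h i).2.1 (h i).2.2).symm
        _ = ∫⁻ m in ⋃ i ∈ Finset.univ, u' i '' A' i,
              ENNReal.ofReal (σ m (e m) * η.toModel m (e m)) ∂μ := by
            refine (lintegral_biUnion_finset ?_ ?_ _).symm
            · exact fun i _ j _ hij => hd hij
            · exact fun i _ => (h i).1.measurableSet_image (h i).2.1 (h i).2.2
        _ ≤ _ := setLIntegral_le_lintegral _ _
    -- The first `N` pieces form an admissible family in the supremum defining `posIntegral`, so
    -- each partial sum is bounded by it.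
    · rw [htotal (fun m e => σ m e * η.toModel m e), ENNReal.tsum_eq_iSup_nat]
      refine iSup_le fun N => ?_
      rw [← Fin.sum_univ_eq_sum_range (fun j => ∫⁻ x in A j, ENNReal.ofReal
        (σ (u j x) (frame (E := E) (u j) x) * η.toModel (u j x) (frame (E := E) (u j) x))) N]
      refine le_trans (le_of_eq ?_) (le_iSup_of_le N <| le_iSup_of_le (fun i => V i) <|
        le_iSup_of_le (fun i => u i) <| le_iSup_of_le (fun i => A i) <| le_iSup_of_le
          ⟨fun i => ⟨hV i, hAm i, hAV i⟩, fun i j hij => hdisj (fun h => hij (Fin.ext h))⟩ le_rfl)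
      rfl

end Reference

namespace IsReference

variable {E : Type*} [NormedAddCommGroup E] [NormedSpace ℝ E]
  {M : Type*} [TopologicalSpace M] [ChartedSpace E M] {k : ℕ}
  {S : Set M} {V : Set (Fin k → ℝ)} {u : (Fin k → ℝ) → M}

variable [MeasurableSpace M] {μ : Measure M} {e : M → Fin k → E} {δ : M → (Fin k → E) → ℝ}
  {A : Set (Fin k → ℝ)}

theorem aestronglyMeasurable (h : IsReference S μ e) (hδ : IsDensity S δ) :
    AEStronglyMeasurable (fun m => δ m (e m)) μ := (h.aemeasurable δ hδ).aestronglyMeasurable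

theorem integrableOn_image (h : IsReference S μ e) (hδ : IsDensity S δ)
    (hu : IsLocalParam E S V u) (hA : MeasurableSet A) (hAV : A ⊆ V)
    (hi : IntegrableOn (fun x => δ (u x) (frame u x)) A) :
    IntegrableOn (fun m => δ m (e m)) (u '' A) μ := by
  refine ⟨(h.aestronglyMeasurable hδ).restrict, ?_⟩
  have := hi.2
  rw [hasFiniteIntegral_iff_norm] at this ⊢
  simp only [Real.norm_eq_abs] at this ⊢
  rwa [h.lintegral_image _ hδ.abs V u A hu hA hAV]

theorem setIntegral_image (h : IsReference S μ e) (hδ : IsDensity S δ)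
    (hu : IsLocalParam E S V u) (hA : MeasurableSet A) (hAV : A ⊆ V)
    (hi : IntegrableOn (fun x => δ (u x) (frame u x)) A) :
    ∫ m in u '' A, δ m (e m) ∂μ = ∫ x in A, δ (u x) (frame u x) := by
  rw [integral_eq_lintegral_pos_part_sub_lintegral_neg_part hi,
    integral_eq_lintegral_pos_part_sub_lintegral_neg_part (h.integrableOn_image hδ hu hA hAV hi),
    h.lintegral_image _ hδ V u A hu hA hAV, h.lintegral_image _ hδ.neg V u A hu hA hAV]

/-- The reference property speaks only of integrals of densities, so nullity of `u '' A` is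
expressed by the vanishing of every density there, through the integral of its absolute value. -/
theorem ae_eq_zero_of_volume_eq_zero (h : IsReference S μ e) (hδ : IsDensity S δ)
    (hu : IsLocalParam E S V u) (hA : MeasurableSet A) (hAV : A ⊆ V) (h0 : volume A = 0) :
    ∀ᵐ m ∂μ.restrict (u '' A), δ m (e m) = 0 := by
  have := h.lintegral_image _ hδ.abs V u A hu hA hAV
  rw [Measure.restrict_eq_zero.2 h0, lintegral_zero_measure, lintegral_eq_zero_iff'
    (h.aemeasurable _ hδ.abs).restrict.ennreal_ofReal] at this
  filter_upwards [this] with m hm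
  simpa using hm

theorem ae_mem (h : IsReference S μ e) : ∀ᵐ m ∂μ, m ∈ S := by
  filter_upwards [h.ae_frame] with m ⟨V, u, x, hu, hx, hm, _⟩
  exact hm ▸ hu.mem hx

end IsReference

/-! ### Stokes' theorem for compactly supported forms on a half-space -/

section Stokes

variable {k : ℕ} {ζ : (Fin (k + 1) → ℝ) → (Fin (k + 1) → ℝ) [⋀^Fin k]→L[ℝ] ℝ}

theorem extDeriv_eq_zero_of_notMem_tsupport {x : Fin (k + 1) → ℝ} (hx : x ∉ tsupport ζ) :
    extDeriv ζ x = 0 := by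
  have h : ζ =ᶠ[nhds x] fun _ => 0 := notMem_tsupport_iff_eventuallyEq.1 hx
  rw [h.extDeriv_eq]
  ext v
  simp [extDeriv, ContinuousAlternatingMap.alternatizeUncurryFin_apply]

theorem volume_coord_eq (i : Fin (k + 1)) (c : ℝ) :
    volume {x : Fin (k + 1) → ℝ | x i = c} = 0 :=
  Measure.pi_hyperplane (μ := fun _ : Fin (k + 1) => (volume : Measure ℝ)) i c

/-- Apply the divergence theorem on a box with upper face `x 0 = c` and all other faces beyond the
support. Only that upper face contributes, and its term carries the sign `(-1)^0 = 1`, in keeping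
with the convention that the outward normal comes first. -/
theorem setIntegral_extDeriv_halfspace (hd : ∀ x, DifferentiableAt ℝ ζ x)
    (hc : Continuous fun x => extDeriv ζ x (stdFrame (k + 1))) (hs : HasCompactSupport ζ) (c : ℝ) :
    ∫ x in {x : Fin (k + 1) → ℝ | x 0 < c}, extDeriv ζ x (stdFrame (k + 1)) =
      ∫ y : Fin k → ℝ, ζ (Fin.cons c y) (fun i => stdFrame (k + 1) i.succ) := by
  -- Taking `R > |c|` makes `-R ≤ c`, so the box is well formed, while `ζ` vanishes wherever some
  -- coordinate reaches `R` in absolute value.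
  obtain ⟨R, hcR, hR⟩ := hs.isCompact.isBounded.subset_ball_lt |c| 0
  have hR0 : 0 < R := (abs_nonneg c).trans_lt hcR
  have hzero : ∀ x i, R ≤ |x i| → x ∉ tsupport ζ := by
    intro x i hi hx
    have := (pi_norm_lt_iff hR0).1 (mem_ball_zero_iff.1 (hR hx)) i
    exact absurd this (not_lt.2 hi)
  let a : Fin (k + 1) → ℝ := fun _ => -R
  let b : Fin (k + 1) → ℝ := Fin.cons c fun _ => R
  have hab : a ≤ b := by
    intro i
    refine Fin.cases ?_ (fun j => ?_) i
    · exact (abs_lt.1 hcR).1.le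
    · change -R ≤ R
      linarith
  let f : Fin (k + 1) → (Fin (k + 1) → ℝ) → ℝ := fun i x =>
    (-1 : ℝ) ^ i.val • ζ x (i.removeNth (stdFrame (k + 1)))
  have hfd : ∀ (i : Fin (k + 1)) x, DifferentiableAt ℝ (fun x => ζ x (i.removeNth (stdFrame (k + 1)))) x :=
    fun i x => (ContinuousAlternatingMap.apply ℝ (Fin (k + 1) → ℝ) ℝ
      (i.removeNth (stdFrame (k + 1)))).differentiableAt.comp x (hd x)
  have hf' : ∀ i x, HasFDerivAt (f i)
      ((-1 : ℝ) ^ i.val • fderiv ℝ (fun x => ζ x (i.removeNth (stdFrame (k + 1)))) x) x :=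
    fun i x => (hfd i x).hasFDerivAt.const_smul ((-1 : ℝ) ^ i.val)
  have hsum : ∀ x, ∑ i : Fin (k + 1), ((-1 : ℝ) ^ i.val •
      fderiv ℝ (fun x => ζ x (i.removeNth (stdFrame (k + 1)))) x) (Pi.single i 1) =
        extDeriv ζ x (stdFrame (k + 1)) := by
    intro x
    rw [extDeriv_apply (hd x)]
    simp [stdFrame]
  have hdiv := integral_divergence_of_hasFDerivAt_off_countable' a b hab f
    (fun i x => (-1 : ℝ) ^ i.val • fderiv ℝ (fun x => ζ x (i.removeNth (stdFrame (k + 1)))) x) ∅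
    countable_empty (fun i x _ => (hf' i x).continuousAt.continuousWithinAt)
    (fun x _ i => hf' i x)
    (by simp only [hsum]; exact hc.continuousOn.integrableOn_compact isCompact_Icc)
  simp only [hsum] at hdiv
  have hfz : ∀ i x j, R ≤ |x j| → f i x = 0 := by
    intro i x j hj
    simp [f, image_eq_zero_of_notMem_tsupport (hzero x j hj)]
  have hleft : ∫ x in {x : Fin (k + 1) → ℝ | x 0 < c}, extDeriv ζ x (stdFrame (k + 1)) =
      ∫ x in Icc a b, extDeriv ζ x (stdFrame (k + 1)) := by
    have hae : {x : Fin (k + 1) → ℝ | x 0 < c} =ᵐ[volume] {x : Fin (k + 1) → ℝ | x 0 ≤ c} := by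
      have h0 : ∀ᵐ x : Fin (k + 1) → ℝ, x 0 ≠ c := by
        rw [ae_iff]; simpa using volume_coord_eq (k := k) 0 c
      filter_upwards [h0] with x hx
      exact propext ⟨fun h : x 0 < c => h.le, fun h : x 0 ≤ c => lt_of_le_of_ne h hx⟩
    rw [setIntegral_congr_set hae]
    refine setIntegral_eq_of_subset_of_forall_sdiff_eq_zero
      (measurableSet_le (measurable_pi_apply 0) measurable_const) (fun x hx => hx.2 0) ?_
    rintro x ⟨hx0, hx⟩
    have : ∃ i, R ≤ |x i| := by
      by_contra! hcon
      refine hx ⟨fun i => (abs_lt.1 (hcon i)).1.le, fun i => ?_⟩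
      refine Fin.cases hx0 (fun j => ?_) i
      exact (abs_lt.1 (hcon j.succ)).2.le
    obtain ⟨i, hi⟩ := this
    rw [extDeriv_eq_zero_of_notMem_tsupport (hzero x i hi)]
    rfl
  rw [hleft, hdiv, Fin.sum_univ_succ, Finset.sum_eq_zero, add_zero]
  · have h1 : ∀ y : Fin k → ℝ, f 0 (Fin.insertNth 0 (a 0) y) = 0 := fun y =>
      hfz 0 _ 0 (by simp [a, abs_of_pos hR0])
    simp only [h1, integral_zero, sub_zero]
    have h2 : ∀ y : Fin k → ℝ, f 0 (Fin.insertNth 0 (b 0) y) =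
        ζ (Fin.cons c y) (fun i => stdFrame (k + 1) i.succ) := by
      intro y
      simp only [f, b, Fin.insertNth_zero', Fin.cons_zero, Fin.val_zero, pow_zero, one_smul]
      rfl
    simp only [h2]
    refine setIntegral_eq_integral_of_forall_compl_eq_zero fun y hy => ?_
    have : ∃ i, R ≤ |y i| := by
      by_contra! hcon
      exact hy ⟨fun i => (abs_lt.1 (hcon i)).1.le, fun i => (abs_lt.1 (hcon i)).2.le⟩
    obtain ⟨i, hi⟩ := this
    rw [image_eq_zero_of_notMem_tsupport (hzero (Fin.cons c y) i.succ (by simpa using hi))]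
    rfl
  · intro i _
    have h1 : ∀ y : Fin k → ℝ, f i.succ (Fin.insertNth i.succ (a i.succ) y) = 0 := fun y =>
      hfz _ _ i.succ (by simp [a, abs_of_pos hR0])
    have h2 : ∀ y : Fin k → ℝ, f i.succ (Fin.insertNth i.succ (b i.succ) y) = 0 := fun y =>
      hfz _ _ i.succ (by simp [b, abs_of_pos hR0])
    simp only [h1, h2, sub_self, integral_zero]

theorem integral_extDeriv_eq_zero (hd : ∀ x, DifferentiableAt ℝ ζ x)
    (hc : Continuous fun x => extDeriv ζ x (stdFrame (k + 1))) (hs : HasCompactSupport ζ) :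
    ∫ x, extDeriv ζ x (stdFrame (k + 1)) = 0 := by
  obtain ⟨R, hR0, hR⟩ := hs.isCompact.isBounded.subset_ball_lt 0 0
  have hzero : ∀ x : Fin (k + 1) → ℝ, R ≤ |x 0| → x ∉ tsupport ζ := by
    intro x hi hx
    have := (pi_norm_lt_iff hR0).1 (mem_ball_zero_iff.1 (hR hx)) 0
    exact absurd this (not_lt.2 hi)
  -- The bounding hyperplane `x 0 = R` lies beyond the support, so the half-space contains
  -- everything and the boundary term is zero.
  have h := setIntegral_extDeriv_halfspace hd hc hs R
  rw [setIntegral_eq_integral_of_forall_compl_eq_zero] at h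
  · rw [h]
    refine integral_eq_zero_of_ae (Filter.Eventually.of_forall fun y => ?_)
    beta_reduce
    rw [image_eq_zero_of_notMem_tsupport
      (hzero (Fin.cons R y) (by simpa using le_abs_self R))]
    rfl
  · intro x hx
    rw [extDeriv_eq_zero_of_notMem_tsupport (hzero x ((not_lt.1 hx).trans (le_abs_self _)))]
    rfl

end Stokes

/-! ### Parametrizations adapted to a hypersurface -/

section Adapted

variable {E : Type*} [NormedAddCommGroup E] [NormedSpace ℝ E]
  {M : Type*} [TopologicalSpace M] [ChartedSpace E M] {k : ℕ}
  {N S : Set M}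

theorem IsLocalParam.comp_symm {V V' : Set (Fin k → ℝ)} {u : (Fin k → ℝ) → M}
    (h : IsLocalParam E N V u) (e : OpenPartialHomeomorph (Fin k → ℝ) (Fin k → ℝ))
    (he : e.source ⊆ V) (hV' : V' ⊆ e.target) (hV'o : IsOpen V')
    (hd : ∀ x ∈ e.source, ContDiffAt ℝ ∞ e x ∧
      ∃ e' : (Fin k → ℝ) ≃L[ℝ] Fin k → ℝ, HasFDerivAt e (e' : (Fin k → ℝ) →L[ℝ] Fin k → ℝ) x) :
    IsLocalParam E N V' (u ∘ e.symm) := by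
  have hmap : ∀ y ∈ V', e.symm y ∈ e.source := fun y hy => e.map_target (hV' hy)
  have hsm : ∀ y ∈ V', ContDiffAt ℝ ∞ e.symm y := by
    intro y hy
    obtain ⟨h1, e', h2⟩ := hd _ (hmap y hy)
    exact e.contDiffAt_symm (hV' hy) h2 h1
  refine ⟨hV'o, ?_, ?_, ?_, ?_⟩
  · intro y hy
    exact ((h.contMDiffAt (he (hmap y hy))).comp y (hsm y hy).contMDiffAt).contMDiffWithinAt
  · intro y hy
    obtain ⟨h1, e', h2⟩ := hd _ (hmap y hy)
    have h3 := (e.hasFDerivAt_symm (hV' hy) h2).hasMFDerivAt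
    have h4 := ((h.contMDiffAt (he (hmap y hy))).mdifferentiableAt (by simp)).hasMFDerivAt.comp y h3
    rw [h4.mfderiv]
    exact (h.immersive _ (he (hmap y hy))).comp e'.symm.injective
  · intro y hy z hz hyz
    exact e.symm.injOn (hV' hy) (hV' hz) (h.injOn (he (hmap y hy)) (he (hmap z hz)) hyz)
  · intro V'' hV'' ho
    rw [image_comp]
    refine h.relOpen _ ?_ (e.isOpen_image_symm_of_subset_target ho (hV''.trans hV'))
    rintro _ ⟨y, hy, rfl⟩
    exact he (hmap y (hV'' hy))

/-- The map `x ↦ (g x, x̂ᵢ - x̂₀ᵢ)` replacing the `i`-th coordinate by `g`. -/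
noncomputable def replaceCoord (g : (Fin (k + 1) → ℝ) → ℝ) (x₀ : Fin (k + 1) → ℝ)
    (i : Fin (k + 1)) (x : Fin (k + 1) → ℝ) : Fin (k + 1) → ℝ :=
  Fin.cons (g x) fun j => x (i.succAbove j) - x₀ (i.succAbove j)

theorem contDiffAt_replaceCoord {g : (Fin (k + 1) → ℝ) → ℝ} {x₀ x : Fin (k + 1) → ℝ}
    {i : Fin (k + 1)} (hg : ContDiffAt ℝ ∞ g x) : ContDiffAt ℝ ∞ (replaceCoord g x₀ i) x := by
  refine contDiffAt_pi.2 fun j => ?_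
  refine Fin.cases hg (fun j => ?_) j
  exact (contDiff_apply ℝ ℝ (i.succAbove j)).contDiffAt.sub contDiffAt_const

theorem hasFDerivAt_replaceCoord {g : (Fin (k + 1) → ℝ) → ℝ} {x₀ x : Fin (k + 1) → ℝ}
    {i : Fin (k + 1)} (hg : ContDiffAt ℝ ∞ g x) (hi : fderiv ℝ g x (stdFrame (k + 1) i) ≠ 0) :
    ∃ e' : (Fin (k + 1) → ℝ) ≃L[ℝ] Fin (k + 1) → ℝ,
      HasFDerivAt (replaceCoord g x₀ i) (e' : (Fin (k + 1) → ℝ) →L[ℝ] Fin (k + 1) → ℝ) x := by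
  let L : (Fin (k + 1) → ℝ) →L[ℝ] Fin (k + 1) → ℝ := ContinuousLinearMap.pi
    (Fin.cons (fderiv ℝ g x) fun j => ContinuousLinearMap.proj (i.succAbove j))
  have hL : HasFDerivAt (replaceCoord g x₀ i) L x := by
    refine hasFDerivAt_pi.2 fun j => ?_
    refine Fin.cases ?_ (fun j => ?_) j
    · exact (hg.differentiableAt (by simp)).hasFDerivAt
    · exact (ContinuousLinearMap.proj (R := ℝ) (φ := fun _ : Fin (k + 1) => ℝ)
        (i.succAbove j)).hasFDerivAt.sub_const _
  have hinj : Injective L.toLinearMap := by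
    refine LinearMap.ker_eq_bot.1 (LinearMap.ker_eq_bot'.2 fun v hv => ?_)
    have h0 : fderiv ℝ g x v = 0 := congrFun hv 0
    have hj : ∀ j, v (i.succAbove j) = 0 := fun j => congrFun hv j.succ
    have hvi : v = v i • stdFrame (k + 1) i := by
      ext l
      rcases Fin.eq_self_or_eq_succAbove i l with rfl | ⟨j, rfl⟩
      · simp [stdFrame]
      · simp [stdFrame, hj]
    rw [hvi, map_smul, smul_eq_mul] at h0
    rw [hvi, (mul_eq_zero.1 h0).resolve_right hi, zero_smul]
  refine ⟨(LinearEquiv.ofInjectiveEndo L.toLinearMap hinj).toContinuousLinearEquiv, ?_⟩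
  exact hL

theorem sum_smul_stdFrame (a : Fin k → ℝ) : ∑ i, a i • stdFrame k i = a := by
  ext j; simp [stdFrame, Finset.sum_apply, Pi.single_apply]

/-- Near a point of a submanifold where the differential of a function `f` does not vanish along
the submanifold, there is a parametrization in which `f` is the first coordinate. -/
theorem IsLocalParam.exists_adapted {V : Set (Fin (k + 1) → ℝ)} {u : (Fin (k + 1) → ℝ) → M}
    (h : IsLocalParam E N V u) {x₀ : Fin (k + 1) → ℝ} (hx₀ : x₀ ∈ V) {f : M → ℝ} {W : Set M}
    (hW : IsOpen W) (hf : ContMDiffOn 𝓘(ℝ, E) 𝓘(ℝ, ℝ) ∞ f W) (hxW : u x₀ ∈ W) (h0 : f (u x₀) = 0)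
    (hd : ∃ a, dFun f (u x₀) (derivMap (E := E) u x₀ a) ≠ 0) :
    ∃ (r : ℝ) (v : (Fin (k + 1) → ℝ) → M), 0 < r ∧ IsLocalParam E N (Metric.ball 0 r) v ∧
      v 0 = u x₀ ∧ ∀ x ∈ Metric.ball 0 r, v x ∈ W ∧ f (v x) = x 0 := by
  have hO : IsOpen (V ∩ u ⁻¹' W) := h.continuousOn.isOpen_inter_preimage h.isOpen hW
  have hgc : ∀ x ∈ V ∩ u ⁻¹' W, ContDiffAt ℝ ∞ (f ∘ u) x := fun x hx =>
    ((hf.contMDiffAt (hW.mem_nhds hx.2)).comp x (h.contMDiffAt hx.1)).contDiffAt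
  have hx₀O : x₀ ∈ V ∩ u ⁻¹' W := ⟨hx₀, hxW⟩
  have hgd : ∀ a, fderiv ℝ (f ∘ u) x₀ a = dFun f (u x₀) (derivMap (E := E) u x₀ a) := by
    intro a
    have := mfderiv_comp x₀ ((hf.contMDiffAt (hW.mem_nhds hxW)).mdifferentiableAt (by simp))
      ((h.contMDiffAt hx₀).mdifferentiableAt (by simp))
    rw [mfderiv_eq_fderiv] at this
    rw [this]
    rfl
  obtain ⟨i, hi⟩ : ∃ i, fderiv ℝ (f ∘ u) x₀ (stdFrame (k + 1) i) ≠ 0 := by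
    by_contra! hcon
    obtain ⟨a, ha⟩ := hd
    rw [← hgd, ← sum_smul_stdFrame a, map_sum] at ha
    exact ha (Finset.sum_eq_zero fun i _ => by rw [map_smul, hcon, smul_zero])
  -- The inverse function theorem is applied at `x₀` only. Restricting to `O`, where the `i`-th
  -- partial derivative stays nonzero, keeps the derivative of `replaceCoord` invertible at every
  -- point, which makes the new parametrization smooth and immersive throughout.
  set O : Set (Fin (k + 1) → ℝ) := (V ∩ u ⁻¹' W) ∩
    (fun x => fderiv ℝ (f ∘ u) x (stdFrame (k + 1) i)) ⁻¹' {0}ᶜ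
  have hcont : ContinuousOn (fun x => fderiv ℝ (f ∘ u) x (stdFrame (k + 1) i)) (V ∩ u ⁻¹' W) :=
    fun x hx => (((hgc x hx).fderiv_right (m := 0) (by norm_cast)).continuousAt.clm_apply
      continuousAt_const).continuousWithinAt
  have hOo : IsOpen O := hcont.isOpen_inter_preimage hO isOpen_compl_singleton
  have hx₀O' : x₀ ∈ O := ⟨hx₀O, hi⟩
  obtain ⟨e', he'⟩ := hasFDerivAt_replaceCoord (x₀ := x₀) (hgc x₀ hx₀O) hi
  have hΦ := contDiffAt_replaceCoord (x₀ := x₀) (i := i) (hgc x₀ hx₀O)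
  set e := (hΦ.toOpenPartialHomeomorph _ he' (by simp)).restrOpen O hOo
  have hcoe : ∀ x, e x = replaceCoord (f ∘ u) x₀ i x := fun x => rfl
  have hsrc : e.source ⊆ O := fun x hx => hx.2
  have hx₀s : x₀ ∈ e.source := ⟨hΦ.mem_toOpenPartialHomeomorph_source he' (by simp), hx₀O'⟩
  have he0 : e x₀ = 0 := by
    rw [hcoe]
    ext j
    refine Fin.cases ?_ (fun j => ?_) j
    · simp [replaceCoord, h0]
    · simp [replaceCoord]
  have hmem : (0 : Fin (k + 1) → ℝ) ∈ e.target := he0 ▸ e.map_source hx₀s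
  obtain ⟨r, hr, hball⟩ := Metric.isOpen_iff.1 e.open_target 0 hmem
  refine ⟨r, u ∘ e.symm, hr, h.comp_symm e (fun x hx => (hsrc hx).1.1) hball Metric.isOpen_ball
    fun x hx => ⟨contDiffAt_replaceCoord (hgc x (hsrc hx).1),
      hasFDerivAt_replaceCoord (hgc x (hsrc hx).1) (hsrc hx).2⟩, ?_, fun x hx => ?_⟩
  · rw [comp_apply, ← he0, e.left_inv hx₀s]
  · have hxs := hsrc (e.map_target (hball hx))
    refine ⟨hxs.1.2, ?_⟩
    have := congrFun (e.right_inv (hball hx)) 0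
    rw [hcoe] at this
    exact this

/-- The inclusion of `ℝᵏ` in `ℝᵏ⁺¹` as the hyperplane where the first coordinate vanishes. -/
noncomputable def consZero (k : ℕ) : (Fin k → ℝ) →L[ℝ] Fin (k + 1) → ℝ :=
  ContinuousLinearMap.pi (Fin.cons 0 fun j => ContinuousLinearMap.proj j)

theorem consZero_apply (y : Fin k → ℝ) : consZero k y = Fin.cons 0 y := by
  ext j
  refine Fin.cases ?_ (fun j => ?_) j <;> simp [consZero]

theorem consZero_injective : Injective (consZero k) := by
  intro y z h
  ext j
  simpa [consZero_apply] using congrFun h j.succ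

theorem consZero_stdFrame (i : Fin k) : consZero k (stdFrame k i) = stdFrame (k + 1) i.succ := by
  ext j
  rw [consZero_apply]
  refine Fin.cases ?_ (fun j => ?_) j
  · simp [stdFrame]
  · simp [stdFrame, Pi.single_apply]

theorem consZero_mem_ball {r : ℝ} {y : Fin k → ℝ} :
    consZero k y ∈ Metric.ball (0 : Fin (k + 1) → ℝ) r ↔ y ∈ Metric.ball (0 : Fin k → ℝ) r := by
  rcases le_or_gt r 0 with hr | hr
  · simp [Metric.ball_eq_empty.2 hr]
  · simp only [mem_ball_zero_iff, pi_norm_lt_iff hr, consZero_apply, Fin.forall_fin_succ]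
    simp [hr]

/-- The vectors are the columns of a block triangular matrix with first row `(a 0, 0, …, 0)` and
lower right block `L`. This computes an orientation of `Γ` on a transverse vector followed by a
frame of the hyperplane. -/
theorem _root_.ContinuousAlternatingMap.apply_cons_consZero
    (g : (Fin (k + 1) → ℝ) [⋀^Fin (k + 1)]→L[ℝ] ℝ) (a : Fin (k + 1) → ℝ)
    (L : (Fin k → ℝ) →L[ℝ] Fin k → ℝ) :
    g (Fin.cons a fun i => consZero k (L (stdFrame k i))) =
      a 0 * L.det * g (stdFrame (k + 1)) := by
  let T : (Fin (k + 1) → ℝ) →L[ℝ] Fin k → ℝ :=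
    ContinuousLinearMap.pi fun j => ContinuousLinearMap.proj j.succ
  let L' : (Fin (k + 1) → ℝ) →L[ℝ] Fin (k + 1) → ℝ :=
    (ContinuousLinearMap.proj (R := ℝ) (φ := fun _ : Fin (k + 1) => ℝ) 0).smulRight a +
      (consZero k).comp (L.comp T)
  have hT0 : T (stdFrame (k + 1) 0) = 0 := by ext j; simp [T, stdFrame]
  have hTs : ∀ i : Fin k, T (stdFrame (k + 1) i.succ) = stdFrame k i := by
    intro i; ext j; simp [T, stdFrame, Pi.single_apply]
  have h0 : L' (stdFrame (k + 1) 0) = a := by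
    simp only [L', add_apply, ContinuousLinearMap.comp_apply, hT0]
    simp [stdFrame]
  have hs : ∀ i : Fin k, L' (stdFrame (k + 1) i.succ) = consZero k (L (stdFrame k i)) := by
    intro i
    simp only [L', add_apply, ContinuousLinearMap.comp_apply, hTs]
    simp [stdFrame]
  have hfr : (Fin.cons a fun i => consZero k (L (stdFrame k i))) =
      fun i => L' (stdFrame (k + 1) i) := by
    ext1 i
    refine Fin.cases ?_ (fun i => ?_) i
    · rw [h0]; rfl
    · rw [hs]; rfl
  have hdet : L'.det = a 0 * L.det := by
    have hM' : ∀ i j, LinearMap.toMatrix' L'.toLinearMap i j = L' (stdFrame (k + 1) j) i := by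
      intro i j
      rw [LinearMap.toMatrix'_apply]
      congr 2
    have hM : ∀ i j, LinearMap.toMatrix' L.toLinearMap i j = L (stdFrame k j) i := by
      intro i j
      rw [LinearMap.toMatrix'_apply]
      congr 2
    change LinearMap.det L'.toLinearMap = a 0 * LinearMap.det L.toLinearMap
    rw [← LinearMap.det_toMatrix', ← LinearMap.det_toMatrix', Matrix.det_succ_row_zero,
      Fin.sum_univ_succ, Finset.sum_eq_zero, add_zero, hM', h0]
    · have : (LinearMap.toMatrix' L'.toLinearMap).submatrix Fin.succ (Fin.succAbove 0) =
          LinearMap.toMatrix' L.toLinearMap := by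
        ext i j
        rw [Matrix.submatrix_apply, hM', hM, Fin.succAbove_zero, hs, consZero_apply]
        rfl
      rw [this]
      simp
    · intro i _
      rw [hM', hs, consZero_apply]
      simp
  rw [hfr, g.apply_linearMap_stdFrame, hdet]

/-- The hyperplane slice of an adapted parametrization parametrizes the intersection with the
hypersurface. -/
theorem IsLocalParam.slice {r : ℝ} {v : (Fin (k + 1) → ℝ) → M}
    (h : IsLocalParam E N (Metric.ball 0 r) v) {f : M → ℝ} {W : Set M} (hW : IsOpen W)
    (hzero : ∀ m ∈ W, f m = 0 ↔ m ∈ S)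
    (hf : ∀ x ∈ Metric.ball 0 r, v x ∈ W ∧ f (v x) = x 0) :
    IsLocalParam E (S ∩ N) (Metric.ball 0 r) (v ∘ consZero k) where
  isOpen := Metric.isOpen_ball
  smooth y hy := ((h.contMDiffAt (consZero_mem_ball.2 hy)).comp y
    (consZero k).contDiff.contDiffAt.contMDiffAt).contMDiffWithinAt
  immersive y hy := by
    have h3 := ((consZero k).hasFDerivAt (x := y)).hasMFDerivAt
    have h4 := ((h.contMDiffAt (consZero_mem_ball.2 hy)).mdifferentiableAt
      (by simp)).hasMFDerivAt.comp y h3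
    rw [h4.mfderiv]
    exact (h.immersive _ (consZero_mem_ball.2 hy)).comp consZero_injective
  injOn y hy z hz hyz := consZero_injective
    (h.injOn (consZero_mem_ball.2 hy) (consZero_mem_ball.2 hz) hyz)
  relOpen V' hV' ho := by
    let T : (Fin (k + 1) → ℝ) → Fin k → ℝ := fun x j => x j.succ
    have hT : Continuous T := by fun_prop
    -- `V'` is thickened to a cylinder, open in the ball, to which relative openness of the ambient
    -- parametrization applies.
    obtain ⟨W', hW', himg⟩ := h.relOpen (Metric.ball 0 r ∩ T ⁻¹' V') inter_subset_left
      (Metric.isOpen_ball.inter (ho.preimage hT))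
    refine ⟨W' ∩ W, hW'.inter hW, ?_⟩
    have hTc : ∀ y, T (consZero k y) = y := fun y => by
      ext j; simp [T, consZero_apply]
    ext m
    constructor
    · rintro ⟨y, hy, rfl⟩
      have hb := consZero_mem_ball.2 (hV' hy)
      have hm : v (consZero k y) ∈ N ∩ W' := himg ▸ ⟨_, ⟨hb, by simpa [hTc] using hy⟩, rfl⟩
      refine ⟨⟨(hzero _ (hf _ hb).1).1 ?_, hm.1⟩, hm.2, (hf _ hb).1⟩
      rw [(hf _ hb).2, consZero_apply]
      rfl
    · rintro ⟨⟨hmS, hmN⟩, hmW', hmW⟩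
      obtain ⟨x, ⟨hx, hxV⟩, rfl⟩ : m ∈ v '' (Metric.ball 0 r ∩ T ⁻¹' V') := by
        rw [himg]; exact ⟨hmN, hmW'⟩
      have hx0 : x 0 = 0 := by rw [← (hf x hx).2]; exact (hzero _ hmW).2 hmS
      refine ⟨T x, hxV, ?_⟩
      have : consZero k (T x) = x := by
        rw [consZero_apply]
        ext j
        refine Fin.cases ?_ (fun j => ?_) j
        · simp [hx0]
        · simp [T]
      simp [this]

theorem IsLocalParam.derivMap_slice {r : ℝ} {v : (Fin (k + 1) → ℝ) → M}
    (h : IsLocalParam E N (Metric.ball 0 r) v) {y : Fin k → ℝ} (hy : y ∈ Metric.ball 0 r) :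
    derivMap (E := E) (v ∘ consZero k) y = (derivMap v (consZero k y)).comp (consZero k) := by
  have h3 := ((consZero k).hasFDerivAt (x := y)).hasMFDerivAt
  have h4 := ((h.contMDiffAt (consZero_mem_ball.2 hy)).mdifferentiableAt
    (by simp)).hasMFDerivAt.comp y h3
  exact h4.mfderiv

end Adapted

/-! ### The densities of forms on `Γ` and on `S ∩ Γ` -/

section FormDensity

variable {E : Type*} [NormedAddCommGroup E] [NormedSpace ℝ E]
  {M : Type*} [TopologicalSpace M] [ChartedSpace E M] {k : ℕ}

theorem DiffForm.toModel_derivMap (η : DiffForm E M k) (u : (Fin k → ℝ) → M) (x : Fin k → ℝ)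
    (L : (Fin k → ℝ) →L[ℝ] Fin k → ℝ) :
    η.toModel (u x) (fun i => derivMap u x (L (stdFrame k i))) =
      L.det * η.toModel (u x) (frame u x) :=
  (pullForm u η x).apply_linearMap_stdFrame L

/-- The density on `Γ` defined by a form of top degree. -/
noncomputable def orientedDensity (Γ : OrientedSubmanifold E M k) (θ : DiffForm E M k) (m : M)
    (e : Fin k → E) : ℝ :=
  ((SignType.sign (DiffForm.toModel Γ.orient m e) : SignType) : ℝ) * θ.toModel m e

/-- The density on `S ∩ Γ` defined by a form of top degree. -/
noncomputable def interDensity (S : CoorientedHypersurface E M)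
    (Γ : OrientedSubmanifold E M (k + 1)) (η : DiffForm E M k) (m : M) (e : Fin k → E) : ℝ :=
  interSign S Γ m e * η.toModel m e

/-- Both the orientation and the form are multiplied by `det L`, and `sign (det L) * det L = |det
L|`. -/
theorem isDensity_orientedDensity {Γ : OrientedSubmanifold E M k} {θ : DiffForm E M k}
    (hθ : ∀ (V : Set (Fin k → ℝ)) (u : (Fin k → ℝ) → M), IsLocalParam E Γ.carrier V u →
      ContinuousOn (fun x => θ.toModel (u x) (frame u x)) V) :
    IsDensity Γ.carrier (orientedDensity Γ θ) where
  map_det V u hu x hx L hL := by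
    simp only [orientedDensity, DiffForm.toModel_derivMap, sign_mul, SignType.coe_mul]
    rw [← sign_mul_self L.det]
    ring
  continuousOn V u hu := by
    refine ContinuousOn.mul ?_ (hθ V u hu)
    have h := Γ.orient_continuous V u hu
    exact (continuous_of_discreteTopology (f := fun s : SignType => (s : ℝ))).comp_continuousOn h

theorem dFun_derivMap_adapted {S : CoorientedHypersurface E M}
    {Γ : OrientedSubmanifold E M (k + 1)} {r : ℝ} {v : (Fin (k + 1) → ℝ) → M} {f : M → ℝ} {W : Set M}
    (hv : IsLocalParam E Γ.carrier (Metric.ball 0 r) v)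
    (hf : IsDefiningFun S.carrier S.conormal W f)
    (hvf : ∀ x ∈ Metric.ball 0 r, v x ∈ W ∧ f (v x) = x 0) {x : Fin (k + 1) → ℝ}
    (hx : x ∈ Metric.ball 0 r) (a : Fin (k + 1) → ℝ) :
    dFun f (v x) (derivMap (E := E) v x a) = a 0 := by
  have h := mfderiv_comp x
    ((hf.smooth.contMDiffAt (hf.isOpen.mem_nhds (hvf x hx).1)).mdifferentiableAt (by simp))
    ((hv.contMDiffAt hx).mdifferentiableAt (by simp))
  rw [mfderiv_eq_fderiv] at h
  have heq : f ∘ v =ᶠ[nhds x] fun x => x 0 := by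
    filter_upwards [Metric.isOpen_ball.mem_nhds hx] with z hz
    exact (hvf z hz).2
  have h2 : HasFDerivAt (fun x : Fin (k + 1) → ℝ => x 0)
      (ContinuousLinearMap.proj (R := ℝ) (φ := fun _ : Fin (k + 1) => ℝ) 0) x :=
    (ContinuousLinearMap.proj (R := ℝ) (φ := fun _ : Fin (k + 1) => ℝ) 0).hasFDerivAt
  have h3 := congrArg (fun T : (Fin (k + 1) → ℝ) →L[ℝ] ℝ => T a)
    ((heq.fderiv_eq.symm.trans h).symm.trans h2.fderiv)
  exact h3

variable [IsManifold 𝓘(ℝ, E) ∞ M]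

theorem isDensity_dForm {Γ : OrientedSubmanifold E M (k + 1)} {η : DiffForm E M k}
    (hη : IsSmoothForm η) : IsDensity Γ.carrier (orientedDensity Γ (dForm η)) := by
  refine isDensity_orientedDensity fun V u hu => ?_
  refine (continuousOn_extDeriv_pullForm_apply hu.isOpen hu.smooth hη (stdFrame (k + 1))).congr ?_
  intro x hx
  beta_reduce
  rw [extDeriv_pullForm hu.isOpen hu.smooth hη hx]
  rfl

section Slice

variable {S : CoorientedHypersurface E M} {Γ : OrientedSubmanifold E M (k + 1)} {r : ℝ}
  {v : (Fin (k + 1) → ℝ) → M} {f : M → ℝ} {W : Set M}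

variable [FiniteDimensional ℝ E]

/-- Write `w = dv(a)`. Then `w` is on the positive side of `S` iff `a 0 > 0`, and the orientation of
`(w, e)` is `a 0 * det L` times that of the coordinate frame, so the choice of `w` does not matter.
-/
theorem interSign_slice (hv : IsLocalParam E Γ.carrier (Metric.ball 0 r) v)
    (hf : IsDefiningFun S.carrier S.conormal W f)
    (hvf : ∀ x ∈ Metric.ball 0 r, v x ∈ W ∧ f (v x) = x 0) {y : Fin k → ℝ}
    (hy : y ∈ Metric.ball 0 r) (L : (Fin k → ℝ) →L[ℝ] Fin k → ℝ) :
    interSign S Γ ((v ∘ consZero k) y) (fun i => derivMap (E := E) (v ∘ consZero k) y (L (stdFrame k i))) =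
      if 0 < L.det * DiffForm.toModel Γ.orient (v (consZero k y)) (frame v (consZero k y))
        then 1 else -1 := by
  have hb := consZero_mem_ball.2 hy
  have hmS : v (consZero k y) ∈ S.carrier := by
    refine (hf.zero_iff _ (hvf _ hb).1).1 ?_
    rw [(hvf _ hb).2, consZero_apply]
    rfl
  obtain ⟨-, c, hc, hν⟩ := hf.differential _ ⟨(hvf _ hb).1, hmS⟩
  have hor : ∀ a, DiffForm.toModel Γ.orient (v (consZero k y)) (Fin.cons
      (derivMap (E := E) v (consZero k y) a)
      (fun i => derivMap (E := E) (v ∘ consZero k) y (L (stdFrame k i)))) =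
      a 0 * L.det * DiffForm.toModel Γ.orient (v (consZero k y)) (frame v (consZero k y)) := by
    intro a
    have := (pullForm v Γ.orient (consZero k y)).apply_cons_consZero a L
    rw [pullForm_apply] at this
    refine Eq.trans (congrArg _ ?_) this
    ext1 i
    refine Fin.cases rfl (fun i => ?_) i
    simp only [Fin.cons_succ]
    rw [hv.derivMap_slice hy]
    rfl
  have hνa : ∀ a, 0 < S.conormal (v (consZero k y)) (derivMap (E := E) v (consZero k y) a) ↔
      0 < a 0 := by
    intro a
    have h1 : a 0 = c * S.conormal (v (consZero k y)) (derivMap (E := E) v (consZero k y) a) :=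
      (dFun_derivMap_adapted hv hf hvf hb a).symm.trans (hν (derivMap (E := E) v (consZero k y) a))
    rw [h1]
    exact (mul_pos_iff_of_pos_left hc).symm
  unfold interSign
  congr 1
  refine propext ⟨?_, fun h => ?_⟩
  · rintro ⟨w, hw, hνw, hwo⟩
    obtain ⟨a, rfl⟩ := (hv.tangentSub_eq hb w).1 hw
    have h1 := (hνa a).1 hνw
    have h2 : 0 < a 0 * L.det * DiffForm.toModel Γ.orient (v (consZero k y))
      (frame v (consZero k y)) := (hor a) ▸ hwo
    rw [mul_assoc] at h2
    exact (mul_pos_iff_of_pos_left h1).1 h2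
  · refine ⟨derivMap (E := E) v (consZero k y) (stdFrame (k + 1) 0),
      (hv.tangentSub_eq hb _).2 ⟨_, rfl⟩, (hνa _).2 (by simp [stdFrame]), ?_⟩
    refine lt_of_lt_of_eq ?_ (hor _).symm
    simpa [stdFrame] using h

theorem interDensity_slice (hv : IsLocalParam E Γ.carrier (Metric.ball 0 r) v)
    (hf : IsDefiningFun S.carrier S.conormal W f)
    (hvf : ∀ x ∈ Metric.ball 0 r, v x ∈ W ∧ f (v x) = x 0) (η : DiffForm E M k) {y : Fin k → ℝ}
    (hy : y ∈ Metric.ball 0 r) (L : (Fin k → ℝ) →L[ℝ] Fin k → ℝ) (hL : L.det ≠ 0) :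
    interDensity S Γ η ((v ∘ consZero k) y)
        (fun i => derivMap (E := E) (v ∘ consZero k) y (L (stdFrame k i))) =
      |L.det| * (((SignType.sign (DiffForm.toModel Γ.orient (v (consZero k y))
        (frame v (consZero k y))) : SignType) : ℝ) *
          pullForm v η (consZero k y) (fun i => stdFrame (k + 1) i.succ)) := by
  have ho : DiffForm.toModel Γ.orient (v (consZero k y)) (frame v (consZero k y)) ≠ 0 :=
    Γ.orient_ne_zero _ _ hv _ (consZero_mem_ball.2 hy)
  have hη : η.toModel ((v ∘ consZero k) y) (frame (v ∘ consZero k) y) =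
      pullForm v η (consZero k y) (fun i => stdFrame (k + 1) i.succ) := by
    rw [pullForm_apply]
    refine congrArg _ ?_
    ext1 i
    rw [frame, hv.derivMap_slice hy, ContinuousLinearMap.comp_apply, consZero_stdFrame]
  rw [interDensity, interSign_slice hv hf hvf hy, DiffForm.toModel_derivMap, hη]
  rcases lt_or_gt_of_ne hL with h1 | h1 <;> rcases lt_or_gt_of_ne ho with h2 | h2
  · rw [if_pos (mul_pos_of_neg_of_neg h1 h2), sign_neg h2, abs_of_neg h1]; simp
  · rw [if_neg (mul_neg_of_neg_of_pos h1 h2).not_gt, sign_pos h2, abs_of_neg h1]; simp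
  · rw [if_neg (mul_neg_of_pos_of_neg h1 h2).not_gt, sign_neg h2, abs_of_pos h1]; simp
  · rw [if_pos (mul_pos h1 h2), sign_pos h2, abs_of_pos h1]; simp

theorem interDensity_frame_slice (hv : IsLocalParam E Γ.carrier (Metric.ball 0 r) v)
    (hf : IsDefiningFun S.carrier S.conormal W f)
    (hvf : ∀ x ∈ Metric.ball 0 r, v x ∈ W ∧ f (v x) = x 0) (η : DiffForm E M k) {y : Fin k → ℝ}
    (hy : y ∈ Metric.ball 0 r) :
    interDensity S Γ η ((v ∘ consZero k) y) (frame (v ∘ consZero k) y) =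
      ((SignType.sign (DiffForm.toModel Γ.orient (v (consZero k y))
        (frame v (consZero k y))) : SignType) : ℝ) *
          pullForm v η (consZero k y) (fun i => stdFrame (k + 1) i.succ) := by
  have h1 : (ContinuousLinearMap.id ℝ (Fin k → ℝ)).det = 1 := LinearMap.det_id
  have := interDensity_slice hv hf hvf η hy (ContinuousLinearMap.id ℝ _) (by simp [h1])
  rw [h1, abs_one, one_mul] at this
  exact this

/-- The sign of `S ∩ Γ` is explicit only in the slices of adapted parametrizations;
`IsDensity.of_local` makes it enough to check these. -/
theorem isDensity_interDensity
    (hf : ∀ m ∈ S.carrier ∩ Γ.carrier, ∃ (r : ℝ) (v : (Fin (k + 1) → ℝ) → M) (f : M → ℝ)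
      (W : Set M), 0 < r ∧ IsLocalParam E Γ.carrier (Metric.ball 0 r) v ∧ v 0 = m ∧
      IsDefiningFun S.carrier S.conormal W f ∧
      ∀ x ∈ Metric.ball 0 r, v x ∈ W ∧ f (v x) = x 0)
    {η : DiffForm E M k} (hη : IsSmoothForm η) :
    IsDensity (S.carrier ∩ Γ.carrier) (interDensity S Γ η) := by
  refine IsDensity.of_local fun m hm => ?_
  obtain ⟨r, v, f, W, hr, hv, hvm, hf, hvf⟩ := hf m hm
  refine ⟨Metric.ball 0 r, v ∘ consZero k, hv.slice hf.isOpen hf.zero_iff hvf,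
    ⟨0, Metric.mem_ball_self hr, by simp [hvm]⟩, fun y hy L hL => ?_, ?_⟩
  · rw [interDensity_slice hv hf hvf η hy L hL, interDensity_frame_slice hv hf hvf η hy]
  · refine ContinuousOn.congr ?_ fun y hy => interDensity_frame_slice hv hf hvf η hy
    have hmaps : MapsTo (consZero k) (Metric.ball 0 r) (Metric.ball 0 r) :=
      fun y hy => consZero_mem_ball.2 hy
    refine ContinuousOn.mul ?_ ?_
    · have h := Γ.orient_continuous _ _ hv
      exact (continuous_of_discreteTopology (f := fun s : SignType => (s : ℝ))).comp_continuousOn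
        (h.comp (consZero k).continuous.continuousOn hmaps)
    · exact (continuousOn_pullForm_apply hv.isOpen hv.smooth hη
        (fun i => stdFrame (k + 1) i.succ)).comp (consZero k).continuous.continuousOn hmaps

/-- Around a point where the hypersurface `S` is transverse to `Γ` there is a parametrization of
`Γ` in which a defining function of `S` is the first coordinate. -/
theorem exists_adapted_of_transverse {m : M} (hm : m ∈ S.carrier ∩ Γ.carrier)
    (ht : LinearMap.ker (S.conormal m).toLinearMap ⊔ tangentSub E (k + 1) Γ.carrier m = ⊤)
    (hmW : m ∈ W) (hf : IsDefiningFun S.carrier S.conormal W f) {W' : Set M} (hW' : IsOpen W')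
    (hmW' : m ∈ W') :
    ∃ (r : ℝ) (v : (Fin (k + 1) → ℝ) → M), 0 < r ∧
      IsLocalParam E Γ.carrier (Metric.ball 0 r) v ∧ v 0 = m ∧
      ∀ x ∈ Metric.ball 0 r, v x ∈ W ∩ W' ∧ f (v x) = x 0 := by
  obtain ⟨V, u, hu, x₀, hx₀, rfl⟩ := Γ.exists_param m hm.2
  obtain ⟨hν0, c, hc, hν⟩ := hf.differential _ ⟨hmW, hm.1⟩
  refine hu.exists_adapted hx₀ (hf.isOpen.inter hW') (hf.smooth.mono inter_subset_left)
    ⟨hmW, hmW'⟩ ((hf.zero_iff _ hmW).2 hm.1) ?_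
  by_contra! hcon
  have hle : tangentSub E (k + 1) Γ.carrier (u x₀) ≤
      LinearMap.ker (S.conormal (u x₀)).toLinearMap := by
    intro w hw
    obtain ⟨a, rfl⟩ := (hu.tangentSub_eq hx₀ w).1 hw
    have h1 : c * S.conormal (u x₀) (derivMap (E := E) u x₀ a) = 0 :=
      (hν (derivMap (E := E) u x₀ a)).symm.trans (hcon a)
    exact (mul_eq_zero.1 h1).resolve_left hc.ne'
  rw [sup_eq_left.2 hle] at ht
  refine hν0 (ContinuousLinearMap.ext fun w => ?_)
  have : w ∈ LinearMap.ker (S.conormal (u x₀)).toLinearMap := ht ▸ Submodule.mem_top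
  exact this

end Slice

end FormDensity

/-! ### Stokes' theorem on `Γ` for forms supported near a point -/

section Extension

variable {k : ℕ} {ζ : (Fin (k + 1) → ℝ) → (Fin (k + 1) → ℝ) [⋀^Fin k]→L[ℝ] ℝ}
  {V C : Set (Fin (k + 1) → ℝ)}

theorem eventuallyEq_indicator_of_mem (hV : IsOpen V) {x : Fin (k + 1) → ℝ} (hx : x ∈ V) :
    V.indicator ζ =ᶠ[nhds x] ζ := by
  filter_upwards [hV.mem_nhds hx] with y hy
  exact indicator_of_mem hy _

theorem indicator_eq_zero_of_notMem (hz : ∀ x ∈ V, x ∉ C → ζ x = 0) {x : Fin (k + 1) → ℝ}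
    (hx : x ∉ C) : V.indicator ζ x = 0 := by
  by_cases h : x ∈ V
  · rw [indicator_of_mem h, hz x h hx]
  · exact indicator_of_notMem h _

theorem tsupport_indicator_subset (hC : IsClosed C) (hz : ∀ x ∈ V, x ∉ C → ζ x = 0) :
    tsupport (V.indicator ζ) ⊆ C :=
  closure_minimal (fun x hx => by
    by_contra h
    exact hx (indicator_eq_zero_of_notMem hz h)) hC

theorem differentiableAt_indicator (hV : IsOpen V) (hC : IsClosed C) (hCV : C ⊆ V)
    (hz : ∀ x ∈ V, x ∉ C → ζ x = 0) (hd : ∀ x ∈ V, DifferentiableAt ℝ ζ x)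
    (x : Fin (k + 1) → ℝ) : DifferentiableAt ℝ (V.indicator ζ) x := by
  by_cases hx : x ∈ V
  · exact (eventuallyEq_indicator_of_mem hV hx).differentiableAt_iff.2 (hd x hx)
  · have h : V.indicator ζ =ᶠ[nhds x] fun _ => 0 := notMem_tsupport_iff_eventuallyEq.1
      fun h => hx (hCV (tsupport_indicator_subset hC hz h))
    exact h.differentiableAt_iff.2 (differentiableAt_const _)

theorem continuous_extDeriv_indicator (hV : IsOpen V) (hC : IsClosed C) (hCV : C ⊆ V)
    (hz : ∀ x ∈ V, x ∉ C → ζ x = 0) {b : Fin (k + 1) → Fin (k + 1) → ℝ}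
    (hc : ContinuousOn (fun x => extDeriv ζ x b) V) :
    Continuous fun x => extDeriv (V.indicator ζ) x b := by
  refine continuous_iff_continuousAt.2 fun x => ?_
  by_cases hx : x ∈ V
  · refine (hc.continuousAt (hV.mem_nhds hx)).congr ?_
    filter_upwards [(eventuallyEq_indicator_of_mem (ζ := ζ) hV hx).extDeriv] with y hy
    rw [hy]
  · have h : ∀ᶠ y in nhds x, y ∉ C := hC.isOpen_compl.mem_nhds fun h => hx (hCV h)
    refine (continuousAt_const (y := (0 : ℝ))).congr ?_
    filter_upwards [h] with y hy
    rw [extDeriv_eq_zero_of_notMem_tsupport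
      fun h => hy (tsupport_indicator_subset hC hz h)]
    rfl

end Extension

section LocalStokes

variable {E : Type*} [NormedAddCommGroup E] [NormedSpace ℝ E]
  {M : Type*} [TopologicalSpace M] [ChartedSpace E M] {k : ℕ}

theorem dForm_eq_zero_of_notMem {η : DiffForm E M k} {T : Set M} (hT : IsClosed T)
    (hη : ∀ m ∉ T, η.toModel m = 0) {m : M} (hm : m ∉ T) : (dForm η).toModel m = 0 := by
  have h1 : ∀ᶠ y in nhds (extChartAt 𝓘(ℝ, E) m m), (extChartAt 𝓘(ℝ, E) m).symm y ∈ Tᶜ := by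
    refine (continuousAt_extChartAt_symm (I := 𝓘(ℝ, E)) m).eventually_mem ?_
    rw [extChartAt_to_inv]
    exact hT.isOpen_compl.mem_nhds hm
  have h2 : chartForm η m =ᶠ[nhds (extChartAt 𝓘(ℝ, E) m m)] fun _ => 0 := by
    filter_upwards [h1] with y hy
    ext v
    change η.toModel _ (fun i => chartSymmDeriv m y (v i)) = 0
    rw [hη _ hy]
    rfl
  have h3 : extDeriv (chartForm η m) (extChartAt 𝓘(ℝ, E) m m) = 0 := by
    rw [h2.extDeriv_eq]
    ext v
    simp [extDeriv, ContinuousAlternatingMap.alternatizeUncurryFin_apply]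
  ext v
  change extDeriv (chartForm η m) (extChartAt 𝓘(ℝ, E) m m) (fun i => chartDeriv m m (v i)) = 0
  rw [h3]
  rfl

theorem orientedDensity_dForm_eq_zero {Γ : OrientedSubmanifold E M (k + 1)} {η : DiffForm E M k}
    {T : Set M} (hT : IsClosed T) (hη : ∀ m ∉ T, η.toModel m = 0) {m : M} (hm : m ∉ T)
    (e : Fin (k + 1) → E) : orientedDensity Γ (dForm η) m e = 0 := by
  rw [orientedDensity, dForm_eq_zero_of_notMem hT hη hm]
  simp

variable {Γ : OrientedSubmanifold E M (k + 1)} {r : ℝ} {v : (Fin (k + 1) → ℝ) → M}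
  {x₀ : Fin (k + 1) → ℝ} {W : Set M} {η : DiffForm E M k} {T : Set M}

/-- The extension by zero of the pullback of `η` under a parametrization defined on a ball. -/
noncomputable def ballPullback (v : (Fin (k + 1) → ℝ) → M) (x₀ : Fin (k + 1) → ℝ) (r : ℝ)
    (η : DiffForm E M k) : (Fin (k + 1) → ℝ) → (Fin (k + 1) → ℝ) [⋀^Fin k]→L[ℝ] ℝ :=
  (Metric.ball x₀ r).indicator (pullForm v η)

/-- `W` cuts out of `Γ` the image of the concentric ball of half the radius. -/
structure IsPatch (Γ : OrientedSubmanifold E M (k + 1)) (v : (Fin (k + 1) → ℝ) → M)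
    (x₀ : Fin (k + 1) → ℝ) (r : ℝ) (W : Set M) : Prop where
  pos : 0 < r
  param : IsLocalParam E Γ.carrier (Metric.ball x₀ r) v
  image_eq : ∀ m ∈ Γ.carrier ∩ W, ∃ x ∈ Metric.ball x₀ (r / 2), v x = m
  mem : ∀ x ∈ Metric.ball x₀ (r / 2), v x ∈ W

/-- This is where `Γ` being embedded matters: no other sheet of `Γ` enters `W`. Halving the radius
leaves a closed ball inside the domain of `v`, so that forms supported in `W` pull back to compactly
supported ones. -/
theorem exists_isPatch (hr : 0 < r) (hv : IsLocalParam E Γ.carrier (Metric.ball x₀ r) v)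
    {W' : Set M} (hW' : IsOpen W') (hvW' : ∀ x ∈ Metric.ball x₀ r, v x ∈ W') :
    ∃ W : Set M, IsOpen W ∧ W ⊆ W' ∧ v x₀ ∈ W ∧ IsPatch Γ v x₀ r W := by
  have hsub : Metric.ball x₀ (r / 2) ⊆ Metric.ball x₀ r := Metric.ball_subset_ball (by linarith)
  obtain ⟨W, hW, him⟩ := hv.relOpen (Metric.ball x₀ (r / 2)) hsub Metric.isOpen_ball
  have hmem : ∀ x ∈ Metric.ball x₀ (r / 2), v x ∈ W ∩ W' := fun x hx =>
    ⟨(him ▸ mem_image_of_mem v hx : v x ∈ Γ.carrier ∩ W).2, hvW' x (hsub hx)⟩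
  refine ⟨W ∩ W', hW.inter hW', inter_subset_right,
    hmem x₀ (Metric.mem_ball_self (by linarith)), hr, hv, fun m hm => ?_, hmem⟩
  have : m ∈ v '' Metric.ball x₀ (r / 2) := by
    rw [him]; exact ⟨hm.1, hm.2.1⟩
  exact this

namespace IsPatch

theorem exists_sign (h : IsPatch Γ v x₀ r W) : ∃ s : ℝ, ∀ x ∈ Metric.ball x₀ r,
    ((SignType.sign (DiffForm.toModel Γ.orient (v x) (frame v x)) : SignType) : ℝ) = s := by
  refine ⟨((SignType.sign (DiffForm.toModel Γ.orient (v x₀) (frame v x₀)) : SignType) : ℝ),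
    fun x hx => ?_⟩
  have hpre : IsPreconnected (Metric.ball x₀ r) := (convex_ball x₀ r).isPreconnected
  exact congrArg _ (hpre.constant (Γ.orient_continuous _ _ h.param) hx
    (Metric.mem_ball_self h.pos))

theorem closedBall_subset (h : IsPatch Γ v x₀ r W) :
    Metric.closedBall x₀ (r / 2) ⊆ Metric.ball x₀ r :=
  Metric.closedBall_subset_ball (by linarith [h.pos])

theorem isCompact (h : IsPatch Γ v x₀ r W) (hT : IsClosed T) :
    IsCompact (Metric.closedBall x₀ (r / 2) ∩ v ⁻¹' T) :=
  (isCompact_closedBall x₀ (r / 2)).of_isClosed_subset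
    ((h.param.continuousOn.mono h.closedBall_subset).preimage_isClosed_of_isClosed
      Metric.isClosed_closedBall hT) inter_subset_left

/-- A point of the large ball that is mapped into `T` has the same image as a point of the
half-radius ball, and `v` is injective. Hence the extension by zero is as regular as the pullback.
-/
theorem pullForm_eq_zero (h : IsPatch Γ v x₀ r W) (hTW : T ⊆ W)
    (hηT : ∀ m ∉ T, η.toModel m = 0) : ∀ x ∈ Metric.ball x₀ r,
      x ∉ Metric.closedBall x₀ (r / 2) ∩ v ⁻¹' T → pullForm v η x = 0 := by
  intro x hx hxC
  have hxT : v x ∉ T := by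
    intro hxT
    obtain ⟨z, hz, hzx⟩ := h.image_eq (v x) ⟨h.param.mem hx, hTW hxT⟩
    have := h.param.injOn (h.closedBall_subset (Metric.ball_subset_closedBall hz)) hx hzx
    exact hxC ⟨this ▸ Metric.ball_subset_closedBall hz, hxT⟩
  ext b
  rw [pullForm_apply, hηT _ hxT]
  rfl

theorem tsupport_subset (h : IsPatch Γ v x₀ r W) (hT : IsClosed T) (hTW : T ⊆ W)
    (hηT : ∀ m ∉ T, η.toModel m = 0) :
    tsupport (ballPullback v x₀ r η) ⊆ Metric.closedBall x₀ (r / 2) ∩ v ⁻¹' T :=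
  tsupport_indicator_subset (h.isCompact hT).isClosed (h.pullForm_eq_zero hTW hηT)

theorem hasCompactSupport (h : IsPatch Γ v x₀ r W) (hT : IsClosed T) (hTW : T ⊆ W)
    (hηT : ∀ m ∉ T, η.toModel m = 0) : HasCompactSupport (ballPullback v x₀ r η) :=
  (h.isCompact hT).of_isClosed_subset (isClosed_tsupport _) (h.tsupport_subset hT hTW hηT)

theorem mem_of_mem_tsupport (h : IsPatch Γ v x₀ r W) (hT : IsClosed T) (hTW : T ⊆ W)
    (hηT : ∀ m ∉ T, η.toModel m = 0) {x : Fin (k + 1) → ℝ}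
    (hx : x ∈ tsupport (ballPullback v x₀ r η)) : x ∈ Metric.ball x₀ r ∧ v x ∈ W :=
  have := h.tsupport_subset hT hTW hηT hx
  ⟨h.closedBall_subset this.1, hTW this.2⟩

variable [IsManifold 𝓘(ℝ, E) ∞ M]

theorem differentiableAt (h : IsPatch Γ v x₀ r W) (hT : IsClosed T) (hTW : T ⊆ W)
    (hη : IsSmoothForm η) (hηT : ∀ m ∉ T, η.toModel m = 0) (x : Fin (k + 1) → ℝ) :
    DifferentiableAt ℝ (ballPullback v x₀ r η) x :=
  differentiableAt_indicator Metric.isOpen_ball (h.isCompact hT).isClosed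
    (inter_subset_left.trans h.closedBall_subset) (h.pullForm_eq_zero hTW hηT)
    (fun _ hx => differentiableAt_pullForm h.param.isOpen h.param.smooth hη hx) x

theorem continuous_extDeriv (h : IsPatch Γ v x₀ r W) (hT : IsClosed T) (hTW : T ⊆ W)
    (hη : IsSmoothForm η) (hηT : ∀ m ∉ T, η.toModel m = 0) :
    Continuous fun x => extDeriv (ballPullback v x₀ r η) x (stdFrame (k + 1)) :=
  continuous_extDeriv_indicator Metric.isOpen_ball (h.isCompact hT).isClosed
    (inter_subset_left.trans h.closedBall_subset) (h.pullForm_eq_zero hTW hηT)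
    (continuousOn_extDeriv_pullForm_apply h.param.isOpen h.param.smooth hη _)

theorem extDeriv_eq (h : IsPatch Γ v x₀ r W) (hη : IsSmoothForm η) {x : Fin (k + 1) → ℝ}
    (hx : x ∈ Metric.ball x₀ r) :
    extDeriv (ballPullback v x₀ r η) x = pullForm v (dForm η) x := by
  rw [← extDeriv_pullForm h.param.isOpen h.param.smooth hη hx]
  exact (eventuallyEq_indicator_of_mem Metric.isOpen_ball hx).extDeriv_eq

theorem integrable_extDeriv (h : IsPatch Γ v x₀ r W) (hT : IsClosed T) (hTW : T ⊆ W)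
    (hη : IsSmoothForm η) (hηT : ∀ m ∉ T, η.toModel m = 0) :
    Integrable fun x => extDeriv (ballPullback v x₀ r η) x (stdFrame (k + 1)) := by
  refine (h.continuous_extDeriv hT hTW hη hηT).integrable_of_hasCompactSupport ?_
  refine HasCompactSupport.of_support_subset_isCompact (h.hasCompactSupport hT hTW hηT) fun x hx => ?_
  by_contra hx'
  exact hx (by simp [extDeriv_eq_zero_of_notMem_tsupport hx'])

variable {s : ℝ}

theorem orientedDensity_eq (h : IsPatch Γ v x₀ r W) (hη : IsSmoothForm η)
    (hs : ∀ x ∈ Metric.ball x₀ r,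
      ((SignType.sign (DiffForm.toModel Γ.orient (v x) (frame v x)) : SignType) : ℝ) = s)
    {x : Fin (k + 1) → ℝ} (hx : x ∈ Metric.ball x₀ r) :
    orientedDensity Γ (dForm η) (v x) (frame v x) =
      s * extDeriv (ballPullback v x₀ r η) x (stdFrame (k + 1)) := by
  rw [orientedDensity, hs x hx, h.extDeriv_eq hη hx]
  rfl

variable [MeasurableSpace M] {μ : Measure M} {e : M → Fin (k + 1) → E}

theorem integrable_orientedDensity (h : IsPatch Γ v x₀ r W)
    (hμ : IsReference Γ.carrier μ e) (hT : IsClosed T) (hTW : T ⊆ W)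
    (hη : IsSmoothForm η) (hηT : ∀ m ∉ T, η.toModel m = 0) :
    Integrable (fun m => orientedDensity Γ (dForm η) m (e m)) μ := by
  obtain ⟨s, hs⟩ := h.exists_sign
  have hi : IntegrableOn (fun x => orientedDensity Γ (dForm η) (v x) (frame v x))
      (Metric.ball x₀ r) :=
    ((h.integrable_extDeriv hT hTW hη hηT).const_mul s).integrableOn.congr_fun
      (fun x hx => (h.orientedDensity_eq hη hs hx).symm) measurableSet_ball
  refine (hμ.integrableOn_image (isDensity_dForm hη) h.param measurableSet_ball subset_rfl
    hi).integrable_of_ae_notMem_eq_zero ?_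
  filter_upwards [hμ.ae_mem] with m hm hmn
  refine orientedDensity_dForm_eq_zero hT hηT (fun hmT => hmn ?_) _
  obtain ⟨x, hx, rfl⟩ := h.image_eq m ⟨hm, hTW hmT⟩
  exact ⟨x, h.closedBall_subset (Metric.ball_subset_closedBall hx), rfl⟩

/-- All of `Γ ∩ T` lies in the image of `v`, so the integral can be computed in its coordinates; the
orientation contributes the constant sign `s`. -/
theorem setIntegral_orientedDensity [BorelSpace M] [T2Space M] (h : IsPatch Γ v x₀ r W)
    (hμ : IsReference Γ.carrier μ e) (hT : IsClosed T) (hTW : T ⊆ W)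
    (hη : IsSmoothForm η) (hηT : ∀ m ∉ T, η.toModel m = 0)
    (hs : ∀ x ∈ Metric.ball x₀ r,
      ((SignType.sign (DiffForm.toModel Γ.orient (v x) (frame v x)) : SignType) : ℝ) = s)
    {B : Set M} (hB : MeasurableSet B) (hvB : MeasurableSet (Metric.ball x₀ r ∩ v ⁻¹' B)) :
    ∫ m in B, orientedDensity Γ (dForm η) m (e m) ∂μ =
      s * ∫ x in Metric.ball x₀ r ∩ v ⁻¹' B,
        extDeriv (ballPullback v x₀ r η) x (stdFrame (k + 1)) := by
  have hi : IntegrableOn (fun x => orientedDensity Γ (dForm η) (v x) (frame v x))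
      (Metric.ball x₀ r ∩ v ⁻¹' B) :=
    ((h.integrable_extDeriv hT hTW hη hηT).const_mul s).integrableOn.congr_fun
      (fun x hx => (h.orientedDensity_eq hη hs hx.1).symm) hvB
  have h1 := hμ.setIntegral_image (isDensity_dForm hη) h.param hvB inter_subset_left hi
  rw [setIntegral_congr_fun hvB fun x hx => h.orientedDensity_eq hη hs hx.1,
    integral_const_mul] at h1
  rw [← h1]
  have him := h.param.measurableSet_image hvB inter_subset_left
  rw [← integral_indicator hB, ← integral_indicator him]
  refine integral_congr_ae ?_
  filter_upwards [hμ.ae_mem] with m hm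
  by_cases hmB : m ∈ B
  · rw [indicator_of_mem hmB]
    by_cases hmi : m ∈ v '' (Metric.ball x₀ r ∩ v ⁻¹' B)
    · rw [indicator_of_mem hmi]
    · rw [indicator_of_notMem hmi]
      refine orientedDensity_dForm_eq_zero hT hηT (fun hmT => hmi ?_) _
      obtain ⟨x, hx, rfl⟩ := h.image_eq m ⟨hm, hTW hmT⟩
      exact ⟨x, ⟨h.closedBall_subset (Metric.ball_subset_closedBall hx), hmB⟩, rfl⟩
  · rw [indicator_of_notMem hmB, indicator_of_notMem]
    rintro ⟨x, hx, rfl⟩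
    exact hmB hx.2

end IsPatch

end LocalStokes

theorem IsDefiningFun.isOpen_neg {E : Type*} [NormedAddCommGroup E] [NormedSpace ℝ E]
    {M : Type*} [TopologicalSpace M] [ChartedSpace E M] {S : Set M}
    {ν : ∀ m : M, TangentSpace 𝓘(ℝ, E) m →L[ℝ] ℝ} {W W' : Set M} {f : M → ℝ}
    (hf : IsDefiningFun S ν W f) (hW' : IsOpen W') (hW'W : W' ⊆ W) :
    IsOpen {m | m ∈ W' ∧ f m < 0} :=
  (hf.smooth.continuousOn.mono hW'W).isOpen_inter_preimage hW' isOpen_Iio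

/-! ### Local Stokes theorem for one cooriented hypersurface -/

section Hypersurface

variable {E : Type*} [NormedAddCommGroup E] [NormedSpace ℝ E]
  {M : Type*} [TopologicalSpace M] [T2Space M] [ChartedSpace E M] [IsManifold 𝓘(ℝ, E) ∞ M]
  [MeasurableSpace M] [BorelSpace M] {k : ℕ}
  {S : CoorientedHypersurface E M} {Γ : OrientedSubmanifold E M (k + 1)}
  {μ : Measure M} {e : M → Fin (k + 1) → E} {μ' : Measure M} {e' : M → Fin k → E}
  {f : M → ℝ} {W : Set M} {p : M}

/-- Stokes' theorem for a form `η` supported in a small open set `W'`, on which the defining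
function `f` of `S` bounds the domain `{f < 0}` of `Γ`. -/
structure LocalStokes (S : CoorientedHypersurface E M) (Γ : OrientedSubmanifold E M (k + 1))
    (μ : Measure M) (e : M → Fin (k + 1) → E) (μ' : Measure M) (e' : M → Fin k → E) (f : M → ℝ)
    (W' : Set M) (η : DiffForm E M k) : Prop where
  integrable_inter : Integrable (fun m => interDensity S Γ η m (e' m)) μ'
  integrable : Integrable (fun m => orientedDensity Γ (dForm η) m (e m)) μ
  integral_eq : ∫ m, interDensity S Γ η m (e' m) ∂μ' =
    ∫ m in {m | m ∈ W' ∧ f m < 0}, orientedDensity Γ (dForm η) m (e m) ∂μ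
  ae_eq_zero : ∀ᵐ m ∂μ, m ∈ W' → m ∈ S.carrier → orientedDensity Γ (dForm η) m (e m) = 0

/-- Away from `S` there is no boundary term. `f` has constant sign near `p`, so the region `{f < 0}`
is locally everything, where the integral of an exact compactly supported form is zero, or empty. -/
theorem exists_localStokes_of_notMem (hμ : IsReference Γ.carrier μ e)
    (hμ' : IsReference (S.carrier ∩ Γ.carrier) μ' e')
    (hp : p ∈ Γ.carrier) (hpS : p ∉ S.carrier) (hpW : p ∈ W)
    (hf : IsDefiningFun S.carrier S.conormal W f) :
    ∃ W', IsOpen W' ∧ p ∈ W' ∧ W' ⊆ W ∧ ∀ η : DiffForm E M k, IsSmoothForm η →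
      ∀ T, IsClosed T → T ⊆ W' → (∀ m ∉ T, η.toModel m = 0) →
        LocalStokes S Γ μ e μ' e' f W' η := by
  obtain ⟨V, v, hv, x₀, hx₀, rfl⟩ := Γ.exists_param p hp
  have hfp : f (v x₀) ≠ 0 := fun h => hpS ((hf.zero_iff _ hpW).1 h)
  -- a neighbourhood on which `f` has the sign of `f p`
  obtain ⟨W₁, hW₁, hpW₁, hW₁W, hsign⟩ : ∃ W₁, IsOpen W₁ ∧ v x₀ ∈ W₁ ∧ W₁ ⊆ W ∧
      ((∀ m ∈ W₁, f m < 0) ∨ ∀ m ∈ W₁, 0 < f m) := by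
    rcases lt_or_gt_of_ne hfp with h | h
    · exact ⟨W ∩ f ⁻¹' Iio 0, hf.smooth.continuousOn.isOpen_inter_preimage hf.isOpen isOpen_Iio,
        ⟨hpW, h⟩, inter_subset_left, Or.inl fun m hm => hm.2⟩
    · exact ⟨W ∩ f ⁻¹' Ioi 0, hf.smooth.continuousOn.isOpen_inter_preimage hf.isOpen isOpen_Ioi,
        ⟨hpW, h⟩, inter_subset_left, Or.inr fun m hm => hm.2⟩
  have hO : IsOpen (V ∩ v ⁻¹' W₁) := hv.continuousOn.isOpen_inter_preimage hv.isOpen hW₁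
  obtain ⟨r, hr, hball⟩ := Metric.isOpen_iff.1 hO x₀ ⟨hx₀, hpW₁⟩
  obtain ⟨W', hW', hW'W₁, hpW', hpatch⟩ := exists_isPatch hr
    (hv.mono (hball.trans inter_subset_left) Metric.isOpen_ball) hW₁ fun x hx => (hball hx).2
  have hnot : ∀ m ∈ W', m ∉ S.carrier := by
    intro m hm hmS
    have h0 := (hf.zero_iff m (hW₁W (hW'W₁ hm))).2 hmS
    rcases hsign with h | h
    · exact absurd h0 (h m (hW'W₁ hm)).ne
    · exact absurd h0 (h m (hW'W₁ hm)).ne'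
  refine ⟨W', hW', hpW', hW'W₁.trans hW₁W, fun η hη T hT hTW hηT => ?_⟩
  have hzero : ∀ᵐ m ∂μ', interDensity S Γ η m (e' m) = 0 := by
    filter_upwards [hμ'.ae_mem] with m hm
    rw [interDensity, hηT m fun hmT => hnot m (hTW hmT) hm.1]
    simp
  obtain ⟨s, hs⟩ := hpatch.exists_sign
  have hint : ∫ m, orientedDensity Γ (dForm η) m (e m) ∂μ = 0 := by
    have h1 := hpatch.setIntegral_orientedDensity hμ hT hTW hη hηT hs MeasurableSet.univ
      (by simpa using measurableSet_ball)
    rw [setIntegral_univ, preimage_univ, inter_univ,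
      setIntegral_eq_integral_of_forall_compl_eq_zero, integral_extDeriv_eq_zero
        (hpatch.differentiableAt hT hTW hη hηT) (hpatch.continuous_extDeriv hT hTW hη hηT)
        (hpatch.hasCompactSupport hT hTW hηT), mul_zero] at h1
    · exact h1
    · intro x hx
      rw [extDeriv_eq_zero_of_notMem_tsupport
        fun h => hx (hpatch.mem_of_mem_tsupport hT hTW hηT h).1]
      rfl
  refine ⟨(integrable_zero _ _ _).congr (hzero.mono fun m hm => hm.symm),
    hpatch.integrable_orientedDensity hμ hT hTW hη hηT, ?_,
    Filter.Eventually.of_forall fun m hm hmS => absurd hmS (hnot m hm)⟩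
  rw [integral_eq_zero_of_ae hzero]
  rcases hsign with h | h
  · rw [setIntegral_eq_integral_of_forall_compl_eq_zero, hint]
    intro m hm
    exact orientedDensity_dForm_eq_zero hT hηT
      (fun hmT => hm ⟨hTW hmT, h m (hW'W₁ (hTW hmT))⟩) _
  · rw [show {m | m ∈ W' ∧ f m < 0} = ∅ from
      eq_empty_of_forall_notMem fun m hm => (h m (hW'W₁ hm.1)).not_gt hm.2]
    simp

/-- In an adapted parametrization `{f < 0}` is the half-space `x 0 < 0` and `S ∩ Γ` its boundary
hyperplane. The same sign `s` appears on both sides, since the orientation of `S ∩ Γ` puts the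
outward direction first. -/
theorem exists_localStokes_of_mem [FiniteDimensional ℝ E] (hμ : IsReference Γ.carrier μ e)
    (hμ' : IsReference (S.carrier ∩ Γ.carrier) μ' e')
    (hdens : ∀ η : DiffForm E M k, IsSmoothForm η →
      IsDensity (S.carrier ∩ Γ.carrier) (interDensity S Γ η))
    (hp : p ∈ S.carrier ∩ Γ.carrier)
    (ht : LinearMap.ker (S.conormal p).toLinearMap ⊔ tangentSub E (k + 1) Γ.carrier p = ⊤)
    (hpW : p ∈ W) (hf : IsDefiningFun S.carrier S.conormal W f) :
    ∃ W', IsOpen W' ∧ p ∈ W' ∧ W' ⊆ W ∧ ∀ η : DiffForm E M k, IsSmoothForm η →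
      ∀ T, IsClosed T → T ⊆ W' → (∀ m ∉ T, η.toModel m = 0) →
        LocalStokes S Γ μ e μ' e' f W' η := by
  obtain ⟨r, v, hr, hv, rfl, hvf'⟩ := exists_adapted_of_transverse hp ht hpW hf isOpen_univ
    (mem_univ p)
  have hvf : ∀ x ∈ Metric.ball 0 r, v x ∈ W ∧ f (v x) = x 0 := fun x hx =>
    ⟨(hvf' x hx).1.1, (hvf' x hx).2⟩
  obtain ⟨W', hW', hW'W, hpW', hpatch⟩ := exists_isPatch hr hv hf.isOpen fun x hx => (hvf x hx).1
  refine ⟨W', hW', hpW', hW'W, fun η hη T hT hTW hηT => ?_⟩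
  obtain ⟨s, hs⟩ := hpatch.exists_sign
  have hsl := hv.slice hf.isOpen hf.zero_iff hvf
  have hfr : ∀ y ∈ Metric.ball (0 : Fin k → ℝ) r,
      interDensity S Γ η ((v ∘ consZero k) y) (frame (v ∘ consZero k) y) =
        s * ballPullback v 0 r η (Fin.cons 0 y) (fun i => stdFrame (k + 1) i.succ) := by
    intro y hy
    rw [interDensity_frame_slice hv hf hvf η hy, hs _ (consZero_mem_ball.2 hy), ballPullback,
      ← consZero_apply, indicator_of_mem (consZero_mem_ball.2 hy)]
  have hcont : Continuous fun y : Fin k → ℝ =>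
      ballPullback v 0 r η (Fin.cons 0 y) (fun i => stdFrame (k + 1) i.succ) := by
    have h1 : Continuous (ballPullback v 0 r η) := continuous_iff_continuousAt.2 fun x =>
      (hpatch.differentiableAt hT hTW hη hηT x).continuousAt
    have h2 : Continuous fun y : Fin k → ℝ => (Fin.cons 0 y : Fin (k + 1) → ℝ) := by
      simp only [← consZero_apply]
      exact (consZero k).continuous
    exact Continuous.eval_const (h1.comp h2) _
  have hzero : ∀ y : Fin k → ℝ, y ∉ Metric.ball (0 : Fin k → ℝ) r →
      ballPullback v 0 r η (Fin.cons 0 y) (fun i => stdFrame (k + 1) i.succ) = 0 := by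
    intro y hy
    rw [ballPullback, ← consZero_apply, indicator_of_notMem fun h => hy (consZero_mem_ball.1 h)]
    rfl
  have hi : IntegrableOn (fun y => interDensity S Γ η ((v ∘ consZero k) y)
      (frame (v ∘ consZero k) y)) (Metric.ball 0 r) := by
    refine IntegrableOn.congr_fun ?_ (fun y hy => (hfr y hy).symm) measurableSet_ball
    exact ((hcont.continuousOn.integrableOn_compact (isCompact_closedBall 0 r)).mono_set
      Metric.ball_subset_closedBall).const_mul s
  -- A point of `S ∩ Γ` where `η` is nonzero lies in the patch, and there `f = 0` says that its
  -- first coordinate vanishes.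
  have hae : ∀ᵐ m ∂μ', m ∉ (v ∘ consZero k) '' Metric.ball 0 r →
      interDensity S Γ η m (e' m) = 0 := by
    filter_upwards [hμ'.ae_mem] with m hm hmn
    rw [interDensity, hηT m]
    · simp
    intro hmT
    obtain ⟨x, hx, rfl⟩ := hpatch.image_eq m ⟨hm.2, hTW hmT⟩
    have hx' := hpatch.closedBall_subset (Metric.ball_subset_closedBall hx)
    have hx0 : x 0 = 0 := by rw [← (hvf x hx').2]; exact (hf.zero_iff _ (hvf x hx').1).2 hm.1
    have hxc : consZero k (Fin.tail x) = x := by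
      rw [consZero_apply, ← hx0, Fin.cons_self_tail]
    refine hmn ⟨Fin.tail x, consZero_mem_ball.1 (hxc ▸ hx'), ?_⟩
    rw [comp_apply, hxc]
  have hleft : ∫ m, interDensity S Γ η m (e' m) ∂μ' =
      s * ∫ y : Fin k → ℝ, ballPullback v 0 r η (Fin.cons 0 y)
        (fun i => stdFrame (k + 1) i.succ) := by
    have h1 := hμ'.setIntegral_image (hdens η hη) hsl measurableSet_ball subset_rfl hi
    rw [setIntegral_eq_integral_of_ae_compl_eq_zero hae] at h1
    rw [h1, setIntegral_congr_fun measurableSet_ball hfr, integral_const_mul,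
      setIntegral_eq_integral_of_forall_compl_eq_zero hzero]
  have hpre : Metric.ball 0 r ∩ v ⁻¹' {m | m ∈ W' ∧ f m < 0} =
      (Metric.ball 0 r ∩ v ⁻¹' W') ∩ {x | x 0 < 0} := by
    ext x
    constructor
    · rintro ⟨hx, hxW, hxf⟩
      exact ⟨⟨hx, hxW⟩, by rwa [(hvf x hx).2] at hxf⟩
    · rintro ⟨⟨hx, hxW⟩, hxf⟩
      exact ⟨hx, hxW, by rwa [(hvf x hx).2]⟩
  have hopen : IsOpen (Metric.ball 0 r ∩ v ⁻¹' W') :=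
    hv.continuousOn.isOpen_inter_preimage hv.isOpen hW'
  have hlt : MeasurableSet {x : Fin (k + 1) → ℝ | x 0 < 0} :=
    measurableSet_lt (measurable_pi_apply 0) measurable_const
  refine ⟨(hμ'.integrableOn_image (hdens η hη) hsl measurableSet_ball subset_rfl
    hi).integrable_of_ae_notMem_eq_zero hae, hpatch.integrable_orientedDensity hμ hT hTW hη hηT,
    ?_, ?_⟩
  · rw [hpatch.setIntegral_orientedDensity hμ hT hTW hη hηT hs
      (hf.isOpen_neg hW' hW'W).measurableSet (hpre ▸ hopen.measurableSet.inter hlt), hpre, hleft,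
      ← setIntegral_extDeriv_halfspace (hpatch.differentiableAt hT hTW hη hηT)
        (hpatch.continuous_extDeriv hT hTW hη hηT) (hpatch.hasCompactSupport hT hTW hηT) 0]
    congr 1
    refine setIntegral_eq_of_subset_of_forall_sdiff_eq_zero hlt inter_subset_right ?_
    rintro x ⟨hx0, hx⟩
    rw [extDeriv_eq_zero_of_notMem_tsupport
      fun h => hx ⟨hpatch.mem_of_mem_tsupport hT hTW hηT h, hx0⟩]
    rfl
  -- In the patch, `S ∩ Γ` is the hyperplane `x 0 = 0`, which has Lebesgue measure zero.
  · have hnull := hμ.ae_eq_zero_of_volume_eq_zero (isDensity_dForm hη) hv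
      (A := Metric.ball 0 r ∩ {x | x 0 = 0})
      (measurableSet_ball.inter (measurableSet_eq_fun (measurable_pi_apply 0) measurable_const))
      inter_subset_left (measure_mono_null inter_subset_right (volume_coord_eq 0 0))
    rw [ae_restrict_iff' (hv.measurableSet_image (measurableSet_ball.inter
      (measurableSet_eq_fun (measurable_pi_apply 0) measurable_const)) inter_subset_left)] at hnull
    filter_upwards [hnull, hμ.ae_mem] with m hm hmΓ hmW hmS
    obtain ⟨x, hx, rfl⟩ := hpatch.image_eq m ⟨hmΓ, hmW⟩
    have hx' := hpatch.closedBall_subset (Metric.ball_subset_closedBall hx)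
    refine hm ⟨x, ⟨hx', ?_⟩, rfl⟩
    rw [mem_ofPred_eq, ← (hvf x hx').2]
    exact (hf.zero_iff _ (hvf x hx').1).2 hmS

end Hypersurface

/-! ### Smooth multiples of forms -/

section Multiples

variable {E : Type*} [NormedAddCommGroup E] [NormedSpace ℝ E]
  {M : Type*} [TopologicalSpace M] [ChartedSpace E M] {k : ℕ}

/-- The multiple of a form by a function. -/
def smulForm (χ : M → ℝ) (ρ : DiffForm E M k) : DiffForm E M k := fun m => χ m • ρ.toModel m

theorem smulForm_apply (χ : M → ℝ) (ρ : DiffForm E M k) (m : M) (e : Fin k → E) :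
    (smulForm χ ρ).toModel m e = χ m * ρ.toModel m e := rfl

theorem chartForm_smulForm (χ : M → ℝ) (ρ : DiffForm E M k) (x₀ : M) (y : E) :
    chartForm (smulForm χ ρ) x₀ y =
      χ ((extChartAt 𝓘(ℝ, E) x₀).symm y) • chartForm ρ x₀ y := rfl

theorem IsSmoothForm.smul [IsManifold 𝓘(ℝ, E) ∞ M] {χ : M → ℝ} {ρ : DiffForm E M k}
    (hρ : IsSmoothForm ρ) (hχ : ContMDiff 𝓘(ℝ, E) 𝓘(ℝ, ℝ) ∞ χ) : IsSmoothForm (smulForm χ ρ) := by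
  intro x₀
  have h1 : ContDiffOn ℝ ∞ (fun y => χ ((extChartAt 𝓘(ℝ, E) x₀).symm y))
      (extChartAt 𝓘(ℝ, E) x₀).target :=
    (hχ.comp_contMDiffOn (contMDiffOn_extChartAt_symm x₀)).contDiffOn
  exact h1.smul (hρ x₀)

/-- Only additivity of `d` is involved, so no Leibniz rule is required for the partition of unity.
-/
theorem dForm_smulForm_sum [IsManifold 𝓘(ℝ, E) ∞ M] {ι : Type*} (t : Finset ι) {χ : ι → M → ℝ}
    {ρ : DiffForm E M k} (hρ : IsSmoothForm ρ)
    (hχ : ∀ i ∈ t, ContMDiff 𝓘(ℝ, E) 𝓘(ℝ, ℝ) ∞ (χ i)) (m : M) (e : Fin (k + 1) → E) :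
    (dForm (smulForm (fun m => ∑ i ∈ t, χ i m) ρ)).toModel m e =
      ∑ i ∈ t, (dForm (smulForm (χ i) ρ)).toModel m e := by
  have h1 : chartForm (smulForm (fun m => ∑ i ∈ t, χ i m) ρ) m =
      fun y => ∑ i ∈ t, chartForm (smulForm (χ i) ρ) m y := by
    ext1 y
    simp only [chartForm_smulForm, Finset.sum_smul]
  have h2 : ∀ θ : DiffForm E M k, (dForm θ).toModel m e = extDeriv (chartForm θ m)
      (extChartAt 𝓘(ℝ, E) m m) (fun i => chartDeriv m m (e i)) := fun _ => rfl
  simp only [h2, h1, extDeriv]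
  rw [fderiv_fun_sum fun i hi => (((hρ.smul (hχ i hi)).contDiffAt_chartForm m).differentiableAt
    (by simp))]
  simp only [ContinuousAlternatingMap.alternatizeUncurryFin_apply, _root_.sum_apply,
    ContinuousAlternatingMap.sum_apply, Finset.smul_sum]
  exact Finset.sum_comm

end Multiples

/-! ### Dynamical forms are closed along Hamiltonian curves -/

section Closed

variable {E : Type*} [NormedAddCommGroup E] [NormedSpace ℝ E] [FiniteDimensional ℝ E]
  {M : Type*} [TopologicalSpace M] [ChartedSpace E M] [IsManifold 𝓘(ℝ, E) ∞ M] {k : ℕ}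
  {Ω : DiffForm E M (k + 2)} {H : M → ℝ} {ρ : DiffForm E M k}
  {Γ : OrientedSubmanifold E M (k + 1)} {V : Set (Fin (k + 1) → ℝ)} {u : (Fin (k + 1) → ℝ) → M}
  {x : Fin (k + 1) → ℝ}

/-- On the Hamiltonian frame `w`, `dρ(w) = -Ω(Ξ, w)`, which up to sign is `Ω(w, Ξ) = ± dH(Ξ) = 0`. A
form of top degree on `T_m Γ` that vanishes on one basis vanishes on all. -/
theorem dForm_eq_zero_of_isHamiltonianCurve (hρ : IsDynamical Ω H ρ)
    (hΓ : IsHamiltonianCurve Ω H Γ) (hu : IsLocalParam E Γ.carrier V u) (hx : x ∈ V) :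
    (dForm ρ).toModel (u x) (frame u x) = 0 := by
  obtain ⟨-, Ξ, -, hΞ, hH⟩ := hρ
  obtain ⟨w, hw, hwt, hwΩ⟩ := hΓ (u x) (hu.mem hx)
  choose a ha using fun i => (hu.tangentSub_eq hx (w i)).1 (hwt i)
  -- `L` expresses the Hamiltonian frame in the coordinate frame; linear independence makes its
  -- determinant nonzero.
  let L : (Fin (k + 1) → ℝ) →L[ℝ] Fin (k + 1) → ℝ :=
    LinearMap.toContinuousLinearMap (Fintype.linearCombination ℝ a)
  have hL : ∀ i, L (stdFrame (k + 1) i) = a i := fun i => by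
    simp [L, stdFrame, Fintype.linearCombination_apply, Pi.single_apply]
  have hinj : Injective L := by
    refine (injective_iff_map_eq_zero L).2 fun c hc => ?_
    have h1 : ∑ i, c i • (w i : E) = 0 := by
      have h2 := congrArg (derivMap (E := E) u x) hc
      rw [map_zero] at h2
      refine Eq.trans ?_ h2
      change _ = derivMap (E := E) u x (∑ i, c i • a i)
      rw [map_sum]
      refine Finset.sum_congr rfl fun i _ => ?_
      rw [map_smul, ← ha]
      rfl
    exact funext fun i => Fintype.linearIndependent_iff.1 hw c h1 i
  have hzero : (dForm ρ).toModel (u x) (fun i => derivMap u x (L (stdFrame (k + 1) i))) = 0 := by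
    have h1 : (fun i => derivMap (E := E) u x (L (stdFrame (k + 1) i))) = fun i => (w i : E) := by
      ext1 i
      rw [hL, ← ha]
    rw [h1]
    have h2 := hwΩ (Ξ (u x))
    rw [hH, mul_zero, Fin.snoc_eq_cons_rotate] at h2
    -- Moving `Ξ` from the last slot to the first is a cyclic permutation; its sign is a unit, so
    -- its value is irrelevant.
    have h3 := (Ω.toModel (u x)).toAlternatingMap.map_perm
      (Fin.cons (Ξ (u x)) w : Fin (k + 2) → E) (finRotate (k + 2))
    have h4 : Ω.toModel (u x) (Fin.cons (Ξ (u x)) w : Fin (k + 2) → E) = 0 := by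
      have h5 : (Ω.toModel (u x)).toAlternatingMap
          ((Fin.cons (Ξ (u x)) w : Fin (k + 2) → E) ∘ finRotate (k + 2)) = 0 := h2
      rw [h5] at h3
      exact (smul_eq_zero_iff_eq _).1 h3.symm
    have h5 := hΞ (u x) w
    change Ω.toModel (u x) (Fin.cons (Ξ (u x)) w : Fin (k + 2) → E) + _ = 0 at h5
    rw [h4, zero_add] at h5
    exact h5
  rw [DiffForm.toModel_derivMap] at hzero
  exact (mul_eq_zero.1 hzero).resolve_left (ContinuousLinearMap.det_ne_zero_of_injective hinj)

theorem mem_supportAlong (hu : IsLocalParam E Γ.carrier V u) (hx : x ∈ V)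
    {b : Fin k → Fin (k + 1) → ℝ} (hb : ρ.toModel (u x) (fun i => derivMap u x (b i)) ≠ 0) :
    u x ∈ supportAlong Γ ρ :=
  ⟨hu.mem hx, subset_closure ⟨hu.mem hx, fun i => derivMap (E := E) u x (b i),
    fun i => (hu.tangentSub_eq hx _).2 ⟨b i, rfl⟩, hb⟩⟩

/-- If `χ = 1` on the part of the support of `ρ|_Γ` in the open set `D`, then `d(χ ρ) = dρ` along
`Γ ∩ D`. -/
theorem dForm_smulForm_eq (hρ : IsSmoothForm ρ) {χ : M → ℝ}
    (hχ : ContMDiff 𝓘(ℝ, E) 𝓘(ℝ, ℝ) ∞ χ) {D : Set M} (hD : IsOpen D)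
    (h1 : ∀ m ∈ supportAlong Γ ρ, m ∈ D → χ m = 1) (hu : IsLocalParam E Γ.carrier V u)
    (hx : x ∈ V) (hxD : u x ∈ D) :
    (dForm (smulForm χ ρ)).toModel (u x) (frame u x) = (dForm ρ).toModel (u x) (frame u x) := by
  -- The two pullbacks agree near `x`, not only at `x`, because `D` is open: each nearby point has
  -- `χ = 1` or pullback zero.
  have heq : pullForm u (smulForm χ ρ) =ᶠ[nhds x] pullForm u ρ := by
    filter_upwards [hu.isOpen.mem_nhds hx,
      (hu.contMDiffAt hx).continuousAt.eventually_mem (hD.mem_nhds hxD)] with z hz hzD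
    ext b
    rw [pullForm_apply, pullForm_apply, smulForm_apply]
    by_cases hb : ρ.toModel (u z) (fun i => derivMap u z (b i)) = 0
    · rw [hb, mul_zero]
    · rw [h1 _ (mem_supportAlong hu hz hb) hzD, one_mul]
  have h2 := congrArg (fun T => T (stdFrame (k + 1))) heq.extDeriv_eq
  simp only [extDeriv_pullForm hu.isOpen hu.smooth (hρ.smul hχ) hx,
    extDeriv_pullForm hu.isOpen hu.smooth hρ hx] at h2
  exact h2

end Closed

/-! ### The slice integrals and the conservation law -/

section Conservation

variable {E : Type*} [NormedAddCommGroup E] [NormedSpace ℝ E]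
  {M : Type*} [TopologicalSpace M] [ChartedSpace E M] {k : ℕ}
  {S S₀ S₁ : CoorientedHypersurface E M} {Γ : OrientedSubmanifold E M (k + 1)}
  {ρ : DiffForm E M k}

theorem posIntegral_of_isEmpty [IsEmpty M] (S : Set M)
    (σ : ∀ m : M, (Fin k → TangentSpace 𝓘(ℝ, E) m) → ℝ) (η : DiffForm E M k) :
    posIntegral S σ η = 0 := by
  refine le_antisymm ?_ bot_le
  refine iSup_le fun N => iSup_le fun V => iSup_le fun u => iSup_le fun A => iSup_le fun _ => ?_
  rw [Finset.sum_eq_zero]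
  exact fun i _ => isEmptyElim (u i 0)

theorem sliceIntegral_eq_integral [MeasurableSpace M] {μ : Measure M} {e : M → Fin k → E}
    (hμ : IsReference (S.carrier ∩ Γ.carrier) μ e)
    (hdens : IsDensity (S.carrier ∩ Γ.carrier) (interDensity S Γ ρ))
    (hint : Integrable (fun m => interDensity S Γ ρ m (e m)) μ) :
    IntegrableOnInter S Γ ρ ∧ sliceIntegral S Γ ρ = ∫ m, interDensity S Γ ρ m (e m) ∂μ := by
  have hpos : posIntegral (S.carrier ∩ Γ.carrier) (interSign S Γ) ρ =
      ∫⁻ m, ENNReal.ofReal (interDensity S Γ ρ m (e m)) ∂μ := hμ.posIntegral_eq _ _ hdens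
  have hneg' : ∀ m (b : Fin k → E), interSign S Γ m b * DiffForm.toModel (fun m => -ρ m) m b =
      -interDensity S Γ ρ m b := fun m b => mul_neg _ _
  have hneg : posIntegral (S.carrier ∩ Γ.carrier) (interSign S Γ) (fun m => -ρ m) =
      ∫⁻ m, ENNReal.ofReal (-interDensity S Γ ρ m (e m)) ∂μ := by
    rw [hμ.posIntegral_eq _ _ (by simp only [hneg']; exact hdens.neg)]
    simp only [hneg']
  refine ⟨⟨?_, ?_⟩, ?_⟩
  · rw [hpos]
    exact hint.lintegral_lt_top.ne
  · rw [hneg]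
    exact hint.neg.lintegral_lt_top.ne
  · rw [sliceIntegral, hpos, hneg, integral_eq_lintegral_pos_part_sub_lintegral_neg_part hint]

variable [FiniteDimensional ℝ E] [IsManifold 𝓘(ℝ, E) ∞ M]

/-- `S` is transverse to `Γ`. -/
def IsTransverse (S : CoorientedHypersurface E M) (Γ : OrientedSubmanifold E M (k + 1)) : Prop :=
  ∀ m ∈ S.carrier ∩ Γ.carrier,
    LinearMap.ker (S.conormal m).toLinearMap ⊔ tangentSub E (k + 1) Γ.carrier m = ⊤

namespace IsTransverse

theorem exists_adapted (h : IsTransverse S Γ) {m : M} (hm : m ∈ S.carrier ∩ Γ.carrier) :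
    ∃ (r : ℝ) (v : (Fin (k + 1) → ℝ) → M) (f : M → ℝ)
      (W : Set M), 0 < r ∧ IsLocalParam E Γ.carrier (Metric.ball 0 r) v ∧ v 0 = m ∧
      IsDefiningFun S.carrier S.conormal W f ∧
      ∀ x ∈ Metric.ball 0 r, v x ∈ W ∧ f (v x) = x 0 := by
  obtain ⟨W, f, hmW, hf⟩ := S.exists_defining m hm.1
  obtain ⟨r, v, hr, hv, hvm, hvf⟩ :=
    exists_adapted_of_transverse hm (h m hm) hmW hf isOpen_univ (mem_univ m)
  exact ⟨r, v, f, W, hr, hv, hvm, hf, fun x hx => ⟨(hvf x hx).1.1, (hvf x hx).2⟩⟩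

theorem isDensity (h : IsTransverse S Γ) (hρ : IsSmoothForm ρ) :
    IsDensity (S.carrier ∩ Γ.carrier) (interDensity S Γ ρ) :=
  isDensity_interDensity (fun _ hm => h.exists_adapted hm) hρ

theorem exists_param (h : IsTransverse S Γ) : ∀ m ∈ S.carrier ∩ Γ.carrier,
    ∃ (V : Set (Fin k → ℝ)) (u : (Fin k → ℝ) → M),
      IsLocalParam E (S.carrier ∩ Γ.carrier) V u ∧ m ∈ u '' V := by
  intro m hm
  obtain ⟨r, v, f, W, hr, hv, hvm, hf, hvf⟩ := h.exists_adapted hm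
  exact ⟨Metric.ball 0 r, v ∘ consZero k, hv.slice hf.isOpen hf.zero_iff hvf,
    0, Metric.mem_ball_self hr, by simp [hvm]⟩

/-- The support of `ρ` along `Γ` is defined by vectors tangent to `Γ`, whereas the integral over `S
∩ Γ` sees frames of `S ∩ Γ`; comparison with an adapted slice shows that the latter are tangent to
`Γ`. -/
theorem frame_mem_tangentSub (h : IsTransverse S Γ) {V : Set (Fin k → ℝ)}
    {u : (Fin k → ℝ) → M} (hu : IsLocalParam E (S.carrier ∩ Γ.carrier) V u) {x : Fin k → ℝ}
    (hx : x ∈ V) (i : Fin k) : frame (E := E) u x i ∈ tangentSub E (k + 1) Γ.carrier (u x) := by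
  obtain ⟨r, v, f, W, hr, hv, hvm, hf, hvf⟩ := h.exists_adapted (hu.mem hx)
  have hsl := hv.slice hf.isOpen hf.zero_iff hvf
  have h0 : (v ∘ consZero k) 0 = u x := by simp [hvm]
  have h1 : frame (E := E) u x i ∈ tangentSub E k (S.carrier ∩ Γ.carrier) (u x) :=
    (hu.tangentSub_eq hx _).2 ⟨_, rfl⟩
  rw [← h0] at h1 ⊢
  obtain ⟨a, ha⟩ := (hsl.tangentSub_eq (Metric.mem_ball_self hr) _).1 h1
  rw [hv.derivMap_slice (Metric.mem_ball_self hr)] at ha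
  exact (hv.tangentSub_eq (consZero_mem_ball.2 (Metric.mem_ball_self hr)) _).2
    ⟨consZero k a, ha⟩

theorem interDensity_smulForm_eq (h : IsTransverse S Γ) {χ : M → ℝ}
    (hχ : ∀ m ∈ supportAlong Γ ρ, m ∈ S.carrier → χ m = 1) {V : Set (Fin k → ℝ)}
    {u : (Fin k → ℝ) → M} (hu : IsLocalParam E (S.carrier ∩ Γ.carrier) V u) {x : Fin k → ℝ}
    (hx : x ∈ V) :
    χ (u x) * interDensity S Γ ρ (u x) (frame u x) = interDensity S Γ ρ (u x) (frame u x) := by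
  by_cases h0 : ρ.toModel (u x) (frame u x) = 0
  · simp [interDensity, h0]
  · have hm := hu.mem hx
    rw [hχ (u x) ⟨hm.2, subset_closure ⟨hm.2, frame (E := E) u x,
      fun i => h.frame_mem_tangentSub hu hx i, h0⟩⟩ hm.1, one_mul]

variable [T2Space M] [MeasurableSpace M] [BorelSpace M]
  {μ : Measure M} {e : M → Fin (k + 1) → E} {μ' μ₀ μ₁ : Measure M} {e' e₀ e₁ : M → Fin k → E}

theorem exists_localStokes (h : IsTransverse S Γ) (hμ : IsReference Γ.carrier μ e)
    (hμ' : IsReference (S.carrier ∩ Γ.carrier) μ' e') {p : M} (hp : p ∈ Γ.carrier) {W : Set M}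
    {f : M → ℝ} (hpW : p ∈ W) (hf : IsDefiningFun S.carrier S.conormal W f) :
    ∃ W', IsOpen W' ∧ p ∈ W' ∧ W' ⊆ W ∧ ∀ η : DiffForm E M k, IsSmoothForm η →
      ∀ T, IsClosed T → T ⊆ W' → (∀ m ∉ T, η.toModel m = 0) →
        LocalStokes S Γ μ e μ' e' f W' η := by
  by_cases hpS : p ∈ S.carrier
  · exact exists_localStokes_of_mem hμ hμ' (fun η hη => h.isDensity hη) ⟨hpS, hp⟩ (h p ⟨hpS, hp⟩)
      hpW hf
  · exact exists_localStokes_of_notMem hμ hμ' hp hpS hpW hf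

/-- The difference of the two one-hypersurface statements, combined by `1_D = 1_{f₀ < 0} - 1_{f₁ <
0}`. The relative position of `S₀` and `S₁` never enters. -/
theorem exists_nhds_stokes (h₀ : IsTransverse S₀ Γ) (h₁ : IsTransverse S₁ Γ)
    (hμ : IsReference Γ.carrier μ e) (hμ₀ : IsReference (S₀.carrier ∩ Γ.carrier) μ₀ e₀)
    (hμ₁ : IsReference (S₁.carrier ∩ Γ.carrier) μ₁ e₁) {D : Set M} (hD : IsOpen D)
    (hbd : IsBoundaryDifference D S₀ S₁) {p : M} (hp : p ∈ Γ.carrier) :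
    ∃ U, IsOpen U ∧ p ∈ U ∧ ∀ η : DiffForm E M k, IsSmoothForm η →
      ∀ T, IsClosed T → T ⊆ U → (∀ m ∉ T, η.toModel m = 0) →
        Integrable (fun m => interDensity S₀ Γ η m (e₀ m)) μ₀ ∧
        Integrable (fun m => interDensity S₁ Γ η m (e₁ m)) μ₁ ∧
        Integrable (fun m => orientedDensity Γ (dForm η) m (e m)) μ ∧
        ∫ m, interDensity S₀ Γ η m (e₀ m) ∂μ₀ - ∫ m, interDensity S₁ Γ η m (e₁ m) ∂μ₁ =
          ∫ m in D, orientedDensity Γ (dForm η) m (e m) ∂μ := by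
  obtain ⟨W, f₀, f₁, hpW, hf₀, hf₁, hDW⟩ := hbd p
  obtain ⟨W₀, hW₀, hpW₀, hW₀W, hst₀⟩ := h₀.exists_localStokes hμ hμ₀ hp hpW hf₀
  obtain ⟨W₁, hW₁, hpW₁, hW₁W, hst₁⟩ := h₁.exists_localStokes hμ hμ₁ hp hpW hf₁
  refine ⟨W₀ ∩ W₁, hW₀.inter hW₁, ⟨hpW₀, hpW₁⟩, fun η hη T hT hTU hηT => ?_⟩
  have hs₀ := hst₀ η hη T hT (hTU.trans inter_subset_left) hηT
  have hs₁ := hst₁ η hη T hT (hTU.trans inter_subset_right) hηT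
  refine ⟨hs₀.integrable_inter, hs₁.integrable_inter, hs₀.integrable, ?_⟩
  have hB₀ := (hf₀.isOpen_neg hW₀ hW₀W).measurableSet
  have hB₁ := (hf₁.isOpen_neg hW₁ hW₁W).measurableSet
  rw [hs₀.integral_eq, hs₁.integral_eq, ← integral_indicator hB₀, ← integral_indicator hB₁,
    ← integral_indicator hD.measurableSet,
    ← integral_sub (hs₀.integrable.indicator hB₀) (hs₀.integrable.indicator hB₁)]
  refine integral_congr_ae ?_
  filter_upwards [hs₀.ae_eq_zero, hs₁.ae_eq_zero] with m hm₀ hm₁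
  by_cases hg : orientedDensity Γ (dForm η) m (e m) = 0
  · simp [indicator, hg]
  -- Where the integrand is nonzero the point lies in `T ⊆ W₀ ∩ W₁` and, almost surely, on neither
  -- hypersurface, so the identity of indicator functions is available.
  · have hmT : m ∈ T := by
      by_contra hmT
      exact hg (orientedDensity_dForm_eq_zero hT hηT hmT _)
    have hmW₀ := (hTU hmT).1
    have hmW₁ := (hTU hmT).2
    have key := hDW m (hW₀W hmW₀) (fun h => hg (hm₀ hmW₀ h)) (fun h => hg (hm₁ hmW₁ h))
    simp only [indicator, mem_ofPred_eq, hmW₀, hmW₁, true_and]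
    split_ifs at key ⊢ <;> first | omega | simp

end IsTransverse

/-- Conservation of the integrals of a dynamical form over the slices of a Hamiltonian curve. -/
theorem integrableOnInter_and_sliceIntegral_eq [T2Space M] [SecondCountableTopology M]
    {Ω : DiffForm E M (k + 2)} {H : M → ℝ} (hρ : IsDynamical Ω H ρ)
    (ht₀ : IsTransverse S₀ Γ) (ht₁ : IsTransverse S₁ Γ) {D : Set M} (hD : IsOpen D)
    (hbd : IsBoundaryDifference D S₀ S₁) (hΓ : IsHamiltonianCurve Ω H Γ)
    (hsupp : IsCompact (supportAlong Γ ρ ∩ (closure D ∪ S₀.carrier ∪ S₁.carrier))) :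
    IntegrableOnInter S₀ Γ ρ ∧ IntegrableOnInter S₁ Γ ρ ∧
      sliceIntegral S₀ Γ ρ = sliceIntegral S₁ Γ ρ := by
  rcases isEmpty_or_nonempty M with hM | hM
  · simp [IntegrableOnInter, sliceIntegral, posIntegral_of_isEmpty]
  let _ : MeasurableSpace M := borel M
  have : BorelSpace M := ⟨rfl⟩
  have : LocallyCompactSpace M := ChartedSpace.locallyCompactSpace E M
  obtain ⟨μ, e, hμ⟩ := exists_reference (E := E) Γ.exists_param
  obtain ⟨μ₀, e₀, hμ₀⟩ := exists_reference (E := E) ht₀.exists_param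
  obtain ⟨μ₁, e₁, hμ₁⟩ := exists_reference (E := E) ht₁.exists_param
  set K := supportAlong Γ ρ ∩ (closure D ∪ S₀.carrier ∪ S₁.carrier)
  choose! U hUo hpU hU using fun p (hp : p ∈ Γ.carrier) =>
    ht₀.exists_nhds_stokes ht₁ hμ hμ₀ hμ₁ hD hbd hp
  have hKΓ : ∀ p ∈ K, p ∈ Γ.carrier := fun p hp => hp.1.1
  obtain ⟨t, htK, hcov⟩ := hsupp.elim_nhds_subcover U fun p hp =>
    (hUo p (hKΓ p hp)).mem_nhds (hpU p (hKΓ p hp))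
  have htΓ : ∀ i : t, (i : M) ∈ Γ.carrier := fun i => hKΓ _ (htK _ i.2)
  -- The index set is the finite subcover of `K`, so all later sums are finite. The supports of the
  -- `χ i` are closed in `M` but need not be compact; local Stokes asks only that they be closed and
  -- contained in `U i`.
  obtain ⟨χ, hχ⟩ := SmoothPartitionOfUnity.exists_isSubordinate 𝓘(ℝ, E) hsupp.isClosed
    (fun i : t => U i) (fun i => hUo i (htΓ i)) (fun p hp => by
      obtain ⟨i, hi, hpi⟩ := mem_iUnion₂.1 (hcov hp)
      exact mem_iUnion.2 ⟨⟨i, hi⟩, hpi⟩)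
  have hχ1 : ∀ m ∈ K, ∑ i, χ i m = 1 := fun m hm => by
    rw [← finsum_eq_sum_of_fintype]
    exact χ.sum_eq_one hm
  have hχs : ∀ i, ContMDiff 𝓘(ℝ, E) 𝓘(ℝ, ℝ) ∞ (χ i) := fun i => (χ i).contMDiff
  have hst := fun i : t => hU i (htΓ i) (smulForm (χ i) ρ) (hρ.1.smul (hχs i))
    (tsupport (χ i)) (isClosed_tsupport _) (hχ i) fun m hm => by
      rw [DiffForm.toModel, smulForm, image_eq_zero_of_notMem_tsupport hm, zero_smul]
  have hsum : ∀ (S : CoorientedHypersurface E M) (μ' : Measure M) (e' : M → Fin k → E),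
      IsTransverse S Γ → S.carrier ⊆ S₀.carrier ∪ S₁.carrier →
      IsReference (S.carrier ∩ Γ.carrier) μ' e' →
      (fun m => ∑ i, interDensity S Γ (smulForm (χ i) ρ) m (e' m)) =ᵐ[μ']
        fun m => interDensity S Γ ρ m (e' m) := by
    intro S μ' e' hS hSS hμ'
    filter_upwards [hμ'.ae_frame] with m ⟨V, u, x, hu, hx, hm, hem⟩
    subst hm
    -- `K` contains the support along the hypersurfaces themselves, since their common pieces need
    -- not lie in the closure of `D`.
    rw [hem, ← hS.interDensity_smulForm_eq (χ := fun m => ∑ i, χ i m)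
      (fun m hm hmS => hχ1 m ⟨hm, by
        rcases hSS hmS with h | h
        · exact Or.inl (Or.inr h)
        · exact Or.inr h⟩) hu hx, Finset.sum_mul]
    refine Finset.sum_congr rfl fun i _ => ?_
    simp only [interDensity, smulForm_apply]
    ring
  have hsum₀ := hsum S₀ μ₀ e₀ ht₀ subset_union_left hμ₀
  have hsum₁ := hsum S₁ μ₁ e₁ ht₁ subset_union_right hμ₁
  have hint₀ := (integrable_finsetSum Finset.univ fun i _ => (hst i).1).congr hsum₀
  have hint₁ := (integrable_finsetSum Finset.univ fun i _ => (hst i).2.1).congr hsum₁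
  obtain ⟨hI₀, hv₀⟩ := sliceIntegral_eq_integral hμ₀ (ht₀.isDensity hρ.1) hint₀
  obtain ⟨hI₁, hv₁⟩ := sliceIntegral_eq_integral hμ₁ (ht₁.isDensity hρ.1) hint₁
  refine ⟨hI₀, hI₁, ?_⟩
  -- The difference of the slice integrals is the sum over `i` of local Stokes identities, that is,
  -- the integral over `D` of `∑ d(χ i ρ)`, which along `Γ ∩ D` equals `dρ = 0`.
  rw [hv₀, hv₁, ← sub_eq_zero, ← integral_congr_ae hsum₀, ← integral_congr_ae hsum₁,
    integral_finsetSum _ fun i _ => (hst i).1, integral_finsetSum _ fun i _ => (hst i).2.1,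
    ← Finset.sum_sub_distrib, Finset.sum_congr rfl fun i _ => (hst i).2.2.2,
    ← integral_finsetSum _ fun i _ => (hst i).2.2.1.integrableOn]
  refine setIntegral_eq_zero_of_ae_eq_zero ?_
  filter_upwards [hμ.ae_frame] with m ⟨V, u, x, hu, hx, hm, hem⟩ hmD
  subst hm
  have h1 := dForm_smulForm_eq hρ.1 (χ := fun m => ∑ i, χ i m)
    (ContMDiff.sum fun i _ => hχs i) hD (fun m hm hmD => hχ1 m ⟨hm, Or.inl (Or.inl
      (subset_closure hmD))⟩) hu hx hmD
  rw [dForm_eq_zero_of_isHamiltonianCurve hρ hΓ hu hx,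
    dForm_smulForm_sum Finset.univ hρ.1 fun i _ => hχs i] at h1
  simp only [orientedDensity, ← Finset.mul_sum, hem, h1, mul_zero]

end Conservation

end Multisymplectic

theorem mainTheorem10
    {E : Type*} [NormedAddCommGroup E] [NormedSpace ℝ E] [FiniteDimensional ℝ E]
    {M : Type*} [TopologicalSpace M] [T2Space M] [SecondCountableTopology M]
    [ChartedSpace E M] [IsManifold 𝓘(ℝ, E) ∞ M]
    {k : ℕ}
    (Ω : Multisymplectic.DiffForm E M (k + 2)) (hΩ : Multisymplectic.IsMultisymplectic Ω)
    (H : M → ℝ) (hH : ContMDiff 𝓘(ℝ, E) 𝓘(ℝ, ℝ) ∞ H)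
    (ρ : Multisymplectic.DiffForm E M k) (hρ : Multisymplectic.IsDynamical Ω H ρ)
    (S₀ S₁ : Multisymplectic.CoorientedHypersurface E M)
    (hS₀ : Multisymplectic.IsSlice Ω H S₀) (hS₁ : Multisymplectic.IsSlice Ω H S₁)
    (D : Set M) (hD : IsOpen D) (hbd : Multisymplectic.IsBoundaryDifference D S₀ S₁)
    (Γ : Multisymplectic.OrientedSubmanifold E M (k + 1))
    (hΓ : Multisymplectic.IsHamiltonianCurve Ω H Γ)
    (hsupp : IsCompact
      (Multisymplectic.supportAlong Γ ρ ∩ (closure D ∪ S₀.carrier ∪ S₁.carrier))) :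
    Multisymplectic.IntegrableOnInter S₀ Γ ρ ∧ Multisymplectic.IntegrableOnInter S₁ Γ ρ ∧
      Multisymplectic.sliceIntegral S₀ Γ ρ = Multisymplectic.sliceIntegral S₁ Γ ρ := by
  exact Multisymplectic.integrableOnInter_and_sliceIntegral_eq hρ (hS₀ Γ hΓ) (hS₁ Γ hΓ) hD hbd hΓ
    hsupp
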